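/- Let $A$ be a finite alphabet with $|A|\ge 2$. A set $X\subseteq A^*$ is a (variable-length) code if every word of $X^*$ has exactly one factorization into elements of $X$. For a relation $\tau\subseteq A^*\times A^*$ put $\tau(X)=\{w' : (x,w')\in\tau \text{ for some } x\in X\}$, $\underline\tau=\tau\setminus\{(w,w): w\in A^*\}$ and $\hat\tau=\tau\cup\{(w,w): w\in A^*\}$; $X$ is $\tau$-independent if $\tau(X)\cap X=\emptyset$. For $k\ge 1$ define the edit relations: $(w,w')\in\delta_k$ iff $w'$ is a subsequence of $w$ of length $|w|-k$; $\iota_k=\delta_k^{-1}$; $(w,w')\in\sigma_k$ iff $|w|=|w'|$ and $w,w'$ differ in exactly $k$ positions; $\Delta_k=\bigcup_{1\le j\le k}\delta_j$; $I_k=\bigcup_{1\le j\le k}\iota_j$; $S_k=\bigcup_{1\le j\le k}(\delta_1\cup\iota_1)^j$; $\Lambda_k=\bigcup_{1\le j\le k}(\delta_1\cup\iota_1\cup\sigma_1)^j$. Consider the following conditions on a code $X\subseteq A^*$ and a relation $\tau$: (c2) $X$ is $\underline\tau$-independent, that is, $X\cap\underline\tau(X)=\emptyset$; (c3) for all $x,y\in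 X$, $\tau(x)\cap\tau(y)\ne\emptyset$ implies $x=y$; (c4) $X$ is maximal in the family of $\tau$-independent codes, that is, $X$ is a $\tau$-independent code and is not strictly contained in any $\tau$-independent code; (c5) $\hat\tau(X)$ is a code; (c6) $\underline\tau(X)$ is a code. In each statement below, "decidable" means that for each of the listed families of relations there is an algorithm which, given $k\ge 1$ and a finite automaton recognizing a code $X\subseteq A^*$ (subject to the stated restriction on $X$), decides whether the condition holds. (i) For $\tau\in\{\delta_k,\iota_k,\sigma_k,\Delta_k,I_k,\underline{S_k},\underline{\Lambda_k}\}$ and $X$ a finite code, each of the conditions (c2), (c3), (c4), (c5), (c6) is decidable. (ii) For $\tau\in\{\delta_k,\iota_k,\sigma_k,\Delta_k,I_k,\underline{S_k},\underline{\Lambda_k}\}$ and $X$ a regular code, the conditions (c4) and (c5) are decidable. (iii) For $\tau\in\{\delta_k,\iota_k,\sigma_k,\Delta_k,I_k,S_1,\Lambda_1\}$ and $X$ a regular code, the conditions (c2) and (c6) are decidable. -/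

import Mathlib

namespace EditCodes

open InformationTheory

/-- Binary relations on the words over the alphabet `A`. -/
abbrev WordRel (A : Type*) := SetRel (List A) (List A)

namespace WordRel

variable {A : Type*}

/-- `k`-character deletion: `w'` is a subsequence of `w` of length `|w| - k`. -/
def del (k : ℕ) : WordRel A :=
  {p | p.2.Sublist p.1 ∧ p.2.length + k = p.1.length}

/-- `k`-character insertion: the converse of `k`-character deletion. -/
def ins (k : ℕ) : WordRel A := (del k).inv

/-- `k`-character substitution: two words of the same length that differ in exactly `k`
positions. -/
def sub (k : ℕ) : WordRel A :=
  {p | p.1.length = p.2.length ∧ {i : ℕ | p.1[i]? ≠ p.2[i]?}.ncard = k}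

/-- Deletion of at least one and at most `p` characters. -/
def delUpTo (p : ℕ) : WordRel A := ⋃ k ∈ Set.Icc 1 p, del k

/-- Insertion of at least one and at most `p` characters. -/
def insUpTo (p : ℕ) : WordRel A := ⋃ k ∈ Set.Icc 1 p, ins k

/-- The `n`-fold composition of a relation with itself. -/
def pow (τ : WordRel A) : ℕ → WordRel A
  | 0 => SetRel.id
  | n + 1 => (pow τ n).comp τ

/-- The relation `S_p = ⋃_{1 ≤ k ≤ p} (δ₁ ∪ ι₁)^k`. -/
def indel (p : ℕ) : WordRel A := ⋃ k ∈ Set.Icc 1 p, pow (del 1 ∪ ins 1) k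

/-- The relation `Λ_p = ⋃_{1 ≤ k ≤ p} (δ₁ ∪ ι₁ ∪ σ₁)^k`. -/
def lev (p : ℕ) : WordRel A := ⋃ k ∈ Set.Icc 1 p, pow (del 1 ∪ ins 1 ∪ sub 1) k

/-- The antireflexive restriction of a relation. -/
def antirefl (τ : WordRel A) : WordRel A := τ \ SetRel.id

/-- The reflexive closure of a relation. -/
def reflClosure (τ : WordRel A) : WordRel A := τ ∪ SetRel.id

/-- `X` is `τ`-independent: `τ(X) ∩ X = ∅`. -/
def Independent (τ : WordRel A) (X : Set (List A)) : Prop := τ.image X ∩ X = ∅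

/-- The error-correction constraint: `τ(x) ∩ τ(y) ≠ ∅` implies `x = y`, for all `x, y ∈ X`. -/
def ErrorCorrecting (τ : WordRel A) (X : Set (List A)) : Prop :=
  ∀ x ∈ X, ∀ y ∈ X, (τ.image {x} ∩ τ.image {y}).Nonempty → x = y

/-- `X` is maximal in the family of `τ`-independent codes (in particular `X` is a
`τ`-independent code). -/
def MaximalIndependentCode (τ : WordRel A) (X : Set (List A)) : Prop :=
  Maximal (fun Y : Set (List A) => UniquelyDecodable Y ∧ Independent τ Y) X

end WordRel

/-- A finite automaton written down as finite data: the list of its initial states, the list of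
its transitions and the list of its final states. The states are natural numbers. -/
abbrev FinAut (A : Type*) := List ℕ × List (ℕ × A × ℕ) × List ℕ

namespace FinAut

variable {A : Type*}

/-- The nondeterministic automaton described by the data. -/
def toNFA (M : FinAut A) : NFA A ℕ where
  step p a := {q | (p, a, q) ∈ M.2.1}
  start := {q | q ∈ M.1}
  accept := {q | q ∈ M.2.2}

/-- The set of words recognized by the automaton. -/
def lang (M : FinAut A) : Set (List A) := {w | w ∈ M.toNFA.accepts}

/-- An instance of the decision problems: an integer `k ≥ 1` and a regular code, the latter given
by an automaton. -/
def IsCodeInstance (i : ℕ × FinAut A) : Prop := 1 ≤ i.1 ∧ UniquelyDecodable i.2.lang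

/-- An instance whose code is finite. -/
def IsFiniteCodeInstance (i : ℕ × FinAut A) : Prop := IsCodeInstance i ∧ i.2.lang.Finite

/-- Over a finite alphabet, the sets of words described by such data are exactly the regular
ones. -/
theorem isRegular_iff_exists_lang [Finite A] (L : Language A) :
    L.IsRegular ↔ ∃ M : FinAut A, M.lang = L := by
  classical
  constructor
  · rintro ⟨σ, hσ, D, rfl⟩
    have : Fintype A := Fintype.ofFinite A
    obtain ⟨n, ⟨e⟩⟩ := Finite.exists_equiv_fin σ
    obtain ⟨M, hM⟩ : ∃ M : FinAut A, M = ([(e D.start : ℕ)],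
      (Finset.univ : Finset (σ × A)).toList.map
        (fun p => ((e p.1 : ℕ), p.2, (e (D.step p.1 p.2) : ℕ))),
      ((Finset.univ : Finset σ).filter (· ∈ D.accept)).toList.map (fun s => (e s : ℕ))) :=
      ⟨_, rfl⟩
    refine ⟨M, ?_⟩
    have key : ∀ (w : List A) (s : σ),
        M.toNFA.evalFrom {(e s : ℕ)} w = {(e (D.evalFrom s w) : ℕ)} := by
      intro w
      induction w with
      | nil => intro s; simp
      | cons a w ih =>
        intro s
        rw [NFA.evalFrom_cons, NFA.stepSet_singleton]
        have : M.toNFA.step (e s : ℕ) a = {(e (D.step s a) : ℕ)} := by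
          ext q
          simp only [toNFA, hM, Set.mem_ofPred_eq, List.mem_map, Finset.mem_toList,
            Finset.mem_univ, true_and, Prod.mk.injEq, Prod.exists, Set.mem_singleton_iff]
          constructor
          · rintro ⟨s', a', h1, rfl, rfl⟩
            have : s' = s := e.injective (Fin.ext h1)
            rw [this]
          · rintro rfl
            exact ⟨s, a, rfl, rfl, rfl⟩
        rw [this, ih]
        rfl
    ext w
    have hs : M.toNFA.start = {(e D.start : ℕ)} := by
      ext q; simp [toNFA, hM]
    change w ∈ M.toNFA.accepts ↔ w ∈ D.accepts
    rw [NFA.mem_accepts, hs, key, DFA.mem_accepts]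
    simp only [Set.mem_singleton_iff, exists_eq_right, toNFA, hM, Set.mem_ofPred_eq, List.mem_map,
      Finset.mem_toList, Finset.mem_filter, Finset.mem_univ, true_and]
    constructor
    · rintro ⟨s, h1, h2⟩
      have : s = D.evalFrom D.start w := e.injective (Fin.ext h2)
      rw [this] at h1
      exact h1
    · intro h
      exact ⟨_, h, rfl⟩
  · rintro ⟨M, rfl⟩
    refine Language.IsRegular.of_finite_range_leftQuotient ?_
    have hfin : Set.Finite {q : ℕ | q ∈ M.1 ∨ ∃ t ∈ M.2.1, t.2.2 = q} := by
      refine ((M.1.toFinset ∪ (M.2.1.map (fun t => t.2.2)).toFinset).finite_toSet).subset ?_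
      intro q hq
      simpa using hq
    refine ((hfin.finite_subsets).image (fun S => M.toNFA.acceptsFrom S)).subset ?_
    rintro _ ⟨x, rfl⟩
    refine ⟨M.toNFA.evalFrom M.toNFA.start x, ?_, ?_⟩
    · induction x using List.reverseRecOn with
      | nil => intro q hq; exact Or.inl hq
      | append_singleton x a _ =>
        intro q hq
        rw [NFA.evalFrom_append, NFA.evalFrom_singleton, NFA.mem_stepSet] at hq
        obtain ⟨p, -, hp⟩ := hq
        exact Or.inr ⟨(p, a, q), hp, rfl⟩
    · ext y
      exact (NFA.append_mem_acceptsFrom M.toNFA).symm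

end FinAut

/-- The problem `P` is decidable on the instances that satisfy `promise`: some algorithm
answers it correctly on all of them. -/
def DecidableOn {α : Type*} [Primcodable α] (promise P : α → Prop) : Prop :=
  ∃ D : α → Prop, ComputablePred D ∧ ∀ a, promise a → (D a ↔ P a)

end EditCodes

open EditCodes InformationTheory

/-!
A language with at most `n` left quotients has, if it is nonempty, a word shorter than `n`. Bounds
on the number of left quotients are inherited under boolean operations, quotients, factors, the
Kleene star and the image under the relation of all pairs of distinct words that are linked by an
edit script with a bounded number of edits. Emptiness of any language built this way is thus
decided by a bounded search, and each of the conditions reduces to such an emptiness problem.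

* `Y` is a code if and only if `[] ∉ Y` and no double factorization begins, that is, no `x ∈ Y` and
  `x ++ s ∈ Y` exist for which `s` is nonempty and `s ++ v ∈ Y∗` for some `v ∈ Y∗`.
* A finite language has only words shorter than `n`, so the pairs that violate the error correction
  constraint can be enumerated.
* A regular code that satisfies the independence constraint is maximal among the independent codes
  if and only if it is complete, that is, every word is a factor of `X∗`. If `w` is not a factor,
  then many copies of `w`, padded to an unbordered word, can be added: at least one copy survives
  the edits, so no word of `X` is reached. Conversely, if `X ∪ {z}` is a code for some `z ∉ X`,
  then the Kraft–McMillan inequality gives `X` Bernoulli measure less than `1`. So `X∗`, and by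
  regularity also the set of its factors, has finite measure, whereas the set of all words has not.
-/

namespace EditCodes

open Computability

section Index

variable {A : Type*}

/-- `L` has at most `n` left quotients, that is, the minimal automaton of `L` has at most `n`
states. -/
def HasIndex (L : Language A) (n : ℕ) : Prop := (Set.range L.leftQuotient).encard ≤ n

theorem HasIndex.of_finite {L : Language A} {F : Type*} [Finite F] (φ : List A → F)
    (h : ∀ u u' v, φ u = φ u' → u ++ v ∈ L → u' ++ v ∈ L) : HasIndex L (Nat.card F) := by
  have hφ : Function.FactorsThrough L.leftQuotient φ := fun u u' hu =>
    Language.ext fun v => ⟨h u u' v hu, h u' u v hu.symm⟩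
  have hrange : Set.range L.leftQuotient ⊆
      Set.range (Function.extend φ L.leftQuotient fun _ => L) := by
    rintro _ ⟨u, rfl⟩
    exact ⟨φ u, hφ.extend_apply _ u⟩
  calc (Set.range L.leftQuotient).encard
      ≤ (Set.range (Function.extend φ L.leftQuotient fun _ => L)).encard :=
        Set.encard_le_encard hrange
    _ ≤ (Set.univ : Set F).encard := by
        rw [← Set.image_univ]
        exact Set.encard_image_le _ _
    _ = Nat.card F := by rw [Set.encard_univ, ENat.card_eq_coe_natCard]

theorem HasIndex.exists_map {L : Language A} {n : ℕ} (h : HasIndex L n) :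
    ∃ φ : List A → Fin n, ∀ u u' v, φ u = φ u' → u ++ v ∈ L → u' ++ v ∈ L := by
  have hfin : (Set.range L.leftQuotient).Finite := Set.finite_of_encard_le_coe h
  have hcard : Nat.card (Set.range L.leftQuotient) ≤ n := by
    rw [HasIndex, ← hfin.cast_ncard_eq] at h
    exact_mod_cast h
  have := hfin.to_subtype
  refine ⟨fun u => Fin.castLE hcard (Finite.equivFin _ ⟨L.leftQuotient u, u, rfl⟩),
    fun u u' v hu huv => ?_⟩
  have hq : L.leftQuotient u = L.leftQuotient u' := congrArg Subtype.val
    ((Finite.equivFin _).injective (Fin.castLE_injective hcard hu))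
  rwa [← Language.mem_leftQuotient, ← hq]

theorem hasIndex_singleton (w : List A) : HasIndex {w} (w.length + 2) := by
  classical
  have := HasIndex.of_finite (L := {w})
    (fun u => if h : u <+: w then some (⟨u.length, Nat.lt_succ_of_le h.length_le⟩ :
      Fin (w.length + 1)) else none) fun u u' v h huv => ?_
  · simpa using this
  have hu : u <+: w := ⟨v, huv⟩
  by_cases hu' : u' <+: w
  · simp only [hu, hu', dite_true, Option.some.injEq, Fin.mk.injEq] at h
    rwa [← (List.prefix_of_prefix_length_le hu hu' h.le).eq_of_length h]
  · simp [hu, hu'] at h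

theorem HasIndex.inf {L K : Language A} {n m : ℕ} (hL : HasIndex L n) (hK : HasIndex K m) :
    HasIndex (L ⊓ K) (n * m) := by
  obtain ⟨φ, hφ⟩ := hL.exists_map
  obtain ⟨ψ, hψ⟩ := hK.exists_map
  simpa using HasIndex.of_finite (L := L ⊓ K) (fun u => (φ u, ψ u)) fun u u' v h huv =>
    ⟨hφ _ _ _ (congrArg Prod.fst h) huv.1, hψ _ _ _ (congrArg Prod.snd h) huv.2⟩

theorem HasIndex.compl {L : Language A} {n : ℕ} (hL : HasIndex L n) : HasIndex Lᶜ n := by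
  obtain ⟨φ, hφ⟩ := hL.exists_map
  simpa using HasIndex.of_finite (L := Lᶜ) φ fun u u' v h huv huv' => huv (hφ _ _ _ h.symm huv')

theorem HasIndex.sup {L K : Language A} {n m : ℕ} (hL : HasIndex L n) (hK : HasIndex K m) :
    HasIndex (L ⊔ K) (n * m) := by
  simpa [compl_inf] using (hL.compl.inf hK.compl).compl

theorem HasIndex.leftQuotient {L : Language A} {n : ℕ} (hL : HasIndex L n) (u : List A) :
    HasIndex (L.leftQuotient u) n := by
  obtain ⟨φ, hφ⟩ := hL.exists_map
  simpa using HasIndex.of_finite (fun v => φ (u ++ v)) fun v v' w h hw => by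
    simpa using hφ _ _ w h (by simpa using hw)

/-- The right quotient `L / Z`: the words that some word of `Z` completes to a word of `L`. -/
def rightQuotient (L Z : Language A) : Language A := {u | ∃ v ∈ Z, u ++ v ∈ L}

theorem HasIndex.rightQuotient {L : Language A} {n : ℕ} (hL : HasIndex L n) (Z : Language A) :
    HasIndex (rightQuotient L Z) n := by
  obtain ⟨φ, hφ⟩ := hL.exists_map
  simpa using HasIndex.of_finite (L := EditCodes.rightQuotient L Z) φ fun u u' v h ⟨t, ht, huvt⟩ =>
    ⟨t, ht, by simpa using hφ _ _ (v ++ t) h (by simpa using huvt)⟩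

/-- The language of all factors of the words of `L`. -/
def factors (L : Language A) : Language A := {w | ∃ u v, u ++ w ++ v ∈ L}

theorem HasIndex.factors {L : Language A} {n : ℕ} (hL : HasIndex L n) :
    HasIndex (factors L) (2 ^ n) := by
  obtain ⟨φ, hφ⟩ := hL.exists_map
  have := HasIndex.of_finite (L := EditCodes.factors L) (fun w => Set.range fun u => φ (u ++ w)) ?_
  · simpa [Nat.card_eq_fintype_card] using this
  rintro w w' t hw ⟨u, v, huv⟩
  obtain ⟨u', hu'⟩ := hw ▸ Set.mem_range_self (f := fun u => φ (u ++ w)) u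
  exact ⟨u', v, by simpa using hφ _ _ (t ++ v) hu'.symm (by simpa using huv)⟩

theorem append_mem_kstar {L : Language A} {u v : List A} (hu : u ∈ L∗) (hv : v ∈ L∗) :
    u ++ v ∈ L∗ :=
  kstar_mul_kstar L ▸ Language.append_mem_mul hu hv

theorem append_mem_kstar_iff {L : Language A} {u v : List A} :
    u ++ v ∈ L∗ ↔ (u ∈ L∗ ∧ v ∈ L∗) ∨
      ∃ u₁ u₂ v₁ v₂, u = u₁ ++ u₂ ∧ v = v₁ ++ v₂ ∧ u₁ ∈ L∗ ∧ u₂ ++ v₁ ∈ L ∧ v₂ ∈ L∗ := by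
  constructor
  · rintro ⟨W, hW, hL⟩
    rcases List.flatten_eq_append_iff.1 hW.symm with ⟨as, bs, rfl, rfl, rfl⟩ |
      ⟨as, bs, c, cs, ds, rfl, rfl, rfl⟩
    · simp only [List.mem_append, or_imp, forall_and] at hL
      exact Or.inl ⟨Language.join_mem_kstar hL.1, Language.join_mem_kstar hL.2⟩
    · simp only [List.mem_append, List.mem_cons, or_imp, forall_and, forall_eq] at hL
      exact Or.inr ⟨as.flatten, bs, c :: cs, ds.flatten, rfl, rfl,
        Language.join_mem_kstar hL.1, hL.2.1, Language.join_mem_kstar hL.2.2⟩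
  · rintro (⟨hu, hv⟩ | ⟨u₁, u₂, v₁, v₂, rfl, rfl, h₁, h₂, h₃⟩)
    · exact append_mem_kstar hu hv
    · simpa using append_mem_kstar h₁ (append_mem_kstar (le_kstar (a := L) h₂) h₃)

/-- The class of `u` for `L∗` is determined by the classes for `L` of the suffixes of `u` that
remain after removing a prefix in `L∗`. -/
theorem HasIndex.kstar {L : Language A} {n : ℕ} (hL : HasIndex L n) :
    HasIndex L∗ (2 ^ n * 2) := by
  obtain ⟨φ, hφ⟩ := hL.exists_map
  have := HasIndex.of_finite (L := L∗)
    (fun u => ({f | ∃ u₁ u₂, u = u₁ ++ u₂ ∧ u₁ ∈ L∗ ∧ φ u₂ = f}, u ∈ L∗)) ?_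
  · simpa [Nat.card_eq_fintype_card] using this
  intro u u' v h huv
  obtain ⟨hset, hmem⟩ := Prod.mk.inj h
  rw [append_mem_kstar_iff] at huv ⊢
  rcases huv with ⟨hu, hv⟩ | ⟨u₁, u₂, v₁, v₂, rfl, rfl, h₁, h₂, h₃⟩
  · exact Or.inl ⟨hmem ▸ hu, hv⟩
  · obtain ⟨u₁', u₂', rfl, h₁', hφ'⟩ := (Set.ext_iff.1 hset (φ u₂)).1 ⟨u₁, u₂, rfl, h₁, rfl⟩
    exact Or.inr ⟨u₁', u₂', v₁, v₂, rfl, rfl, h₁', hφ _ _ _ hφ'.symm h₂, h₃⟩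

theorem exists_append_eq_of_length_le {n : ℕ} (φ : List A → Fin n) {w : List A}
    (hw : n ≤ w.length) : ∃ u p v, w = u ++ p ++ v ∧ p ≠ [] ∧ φ u = φ (u ++ p) := by
  obtain ⟨i, j, hij, h⟩ : ∃ i j : Fin (n + 1), i < j ∧ φ (w.take i) = φ (w.take j) := by
    obtain ⟨i, j, hij, h⟩ := Fintype.exists_ne_map_eq_of_card_lt
      (fun i : Fin (n + 1) => φ (w.take i)) (by simp)
    rcases hij.lt_or_gt with hij | hij
    exacts [⟨i, j, hij, h⟩, ⟨j, i, hij, h.symm⟩]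
  have htake : w.take j = w.take i ++ (w.drop i).take (j - i) := by
    rw [← List.take_add, Nat.add_sub_cancel' (Fin.le_def.1 hij.le)]
  refine ⟨w.take i, (w.drop i).take (j - i), w.drop j, ?_, ?_, ?_⟩
  · rw [← htake, List.take_append_drop]
  · rw [← List.length_pos_iff, List.length_take, List.length_drop]
    omega
  · rw [← htake, h]

theorem HasIndex.exists_length_lt {L : Language A} {n : ℕ} (hL : HasIndex L n)
    (h : ∃ w, w ∈ L) : ∃ w ∈ L, w.length < n := by
  obtain ⟨φ, hφ⟩ := hL.exists_map
  obtain ⟨w, hw, hmin⟩ := WellFounded.has_min (measure List.length).wf {w | w ∈ L} h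
  refine ⟨w, hw, not_le.1 fun hle => ?_⟩
  obtain ⟨u, p, v, rfl, hp, huv⟩ := exists_append_eq_of_length_le φ hle
  refine hmin (u ++ v) (hφ _ _ _ huv.symm hw) ?_
  change (u ++ v).length < (u ++ p ++ v).length
  simpa [List.length_pos_iff] using hp

theorem HasIndex.length_lt_of_finite {L : Language A} {n : ℕ} (hL : HasIndex L n)
    (hfin : {w | w ∈ L}.Finite) {w : List A} (hw : w ∈ L) : w.length < n := by
  obtain ⟨φ, hφ⟩ := hL.exists_map
  obtain ⟨m, hm, hmax⟩ := Set.exists_max_image _ List.length hfin ⟨w, hw⟩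
  refine (hmax w hw).trans_lt (not_le.1 fun hle => ?_)
  obtain ⟨u, p, v, rfl, hp, huv⟩ := exists_append_eq_of_length_le φ hle
  have hlonger := hmax (u ++ p ++ (p ++ v)) (hφ _ _ _ huv (by simpa using hm))
  have := List.length_pos_iff.2 hp
  simp only [List.length_append] at hlonger
  omega

end Index

section Code

variable {A : Type*}

theorem uniquelyDecodable_mono {X Y : Set (List A)} (hXY : X ⊆ Y) (hY : UniquelyDecodable Y) :
    UniquelyDecodable X :=
  fun L K hL hK => hY L K (fun w hw => hXY (hL w hw)) (fun w hw => hXY (hK w hw))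

theorem exists_overlap_of_flatten_eq {Y : Language A} (hnil : [] ∉ Y) {L K : List (List A)}
    (hL : ∀ w ∈ L, w ∈ Y) (hK : ∀ w ∈ K, w ∈ Y) (h : L.flatten = K.flatten) (hne : L ≠ K) :
    ∃ x s, x ∈ Y ∧ x ++ s ∈ Y ∧ s ≠ [] ∧ s ∈ rightQuotient Y∗ Y∗ := by
  induction L generalizing K with
  | nil =>
    obtain ⟨y, hy⟩ := List.exists_mem_of_ne_nil K hne.symm
    exact absurd (List.flatten_eq_nil_iff.1 h.symm y hy ▸ hK y hy) hnil
  | cons x L ih =>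
    obtain ⟨hx, hL'⟩ := List.forall_mem_cons.1 hL
    cases K with
    | nil => exact absurd (List.flatten_eq_nil_iff.1 h x (by simp) ▸ hx) hnil
    | cons y K =>
      obtain ⟨hy, hK'⟩ := List.forall_mem_cons.1 hK
      rcases List.append_eq_append_iff.1 h with ⟨s, rfl, hs⟩ | ⟨s, rfl, hs⟩ <;>
        rcases eq_or_ne s [] with rfl | hs₀
      · exact ih hL' hK' hs (by simpa using hne)
      · exact ⟨x, s, hx, hy, hs₀, _, Language.join_mem_kstar hK',
          hs ▸ Language.join_mem_kstar hL'⟩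
      · exact ih hL' hK' hs.symm (by simpa using hne)
      · exact ⟨y, s, hy, hx, hs₀, _, Language.join_mem_kstar hL',
          hs ▸ Language.join_mem_kstar hK'⟩

/-- The overlaps of `Y`: the words `x ∈ Y` such that `x ++ s ∈ Y` for some nonempty `s` which some
product of words of `Y` completes to another such product. They are the beginnings of the double
factorizations over `Y`. -/
def overlaps (Y : Language A) : Language A :=
  Y ⊓ rightQuotient Y (rightQuotient Y∗ Y∗ ⊓ {[]}ᶜ)

theorem uniquelyDecodable_iff {Y : Language A} :
    UniquelyDecodable Y ↔ [] ∉ Y ∧ ¬ ∃ x, x ∈ overlaps Y := by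
  constructor
  · refine fun hY => ⟨hY.epsilon_not_mem, ?_⟩
    rintro ⟨x, hx, s, ⟨⟨_, ⟨K, rfl, hK⟩, L, h, hL⟩, hs⟩, hxs⟩
    have heq := hY (x :: L) ((x ++ s) :: K) (List.forall_mem_cons.2 ⟨hx, hL⟩)
      (List.forall_mem_cons.2 ⟨hxs, hK⟩) (by simp [← h])
    exact hs (List.self_eq_append_right.1 (List.cons.inj heq).1)
  · rintro ⟨hnil, hno⟩ L K hL hK h
    by_contra hne
    obtain ⟨x, s, hx, hxs, hs, hq⟩ := exists_overlap_of_flatten_eq hnil hL hK h hne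
    exact hno ⟨x, hx, s, ⟨hq, hs⟩, hxs⟩

/-- Every word is a factor of some product of words of `X`. -/
def Complete (X : Language A) : Prop := ∀ w, w ∈ factors X∗

end Code

section EditScripts

variable {A : Type*}

/-- An edit script: a word of edit operations on letters, where `(some a, some b)` replaces `a` by
`b` (or keeps it, if `a = b`), `(some a, none)` deletes `a`, `(none, some b)` inserts `b`, and
`(none, none)` is an insertion that is undone at once. -/
abbrev Script (A : Type*) := List (Option A × Option A)

namespace Script

/-- The word that the script edits. -/
def source (e : Script A) : List A := e.filterMap Prod.fst

/-- The word that the script produces. -/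
def target (e : Script A) : List A := e.filterMap Prod.snd

open scoped Classical in
/-- The numbers of deletions, insertions and substitutions of the script. -/
noncomputable def cost (e : Script A) : ℕ × ℕ × ℕ :=
  (e.countP (·.2.isNone), e.countP (·.1.isNone),
    e.countP fun p => p.1.isSome ∧ p.2.isSome ∧ p.1 ≠ p.2)

theorem source_append (e e' : Script A) : source (e ++ e') = source e ++ source e' :=
  List.filterMap_append

theorem target_append (e e' : Script A) : target (e ++ e') = target e ++ target e' :=
  List.filterMap_append

theorem cost_append (e e' : Script A) : cost (e ++ e') = cost e + cost e' := by
  simp [cost]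

theorem cost_cons (p : Option A × Option A) (e : Script A) : cost (p :: e) = cost [p] + cost e :=
  cost_append [p] e

theorem cost_deletion (a : A) : cost [(some a, none)] = (1, 0, 0) := by simp [cost]

theorem cost_insertion (b : Option A) : cost [(none, b)] = (if b = none then 1 else 0, 1, 0) := by
  cases b <;> simp [cost]

open scoped Classical in
theorem cost_replacement (a b : A) :
    cost [(some a, some b)] = (0, 0, if a = b then 0 else 1) := by
  by_cases h : a = b <;> simp [cost, h]

theorem source_map_swap (e : Script A) : source (e.map Prod.swap) = target e := by
  simp [source, target, List.filterMap_map]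

theorem target_map_swap (e : Script A) : target (e.map Prod.swap) = source e := by
  simp [source, target, List.filterMap_map]

theorem cost_map_swap (e : Script A) :
    cost (e.map Prod.swap) = ((cost e).2.1, (cost e).1, (cost e).2.2) := by
  simp only [cost, List.countP_map, Function.comp_def, Prod.fst_swap, Prod.snd_swap]
  congr! 3
  ext p
  exact decide_eq_decide.2 (and_left_comm.trans (and_congr_right fun _ => by rw [ne_comm]))

/-- A position that is kept or replaced is counted in the source and in the target. -/
theorem length_source_add (e : Script A) : (source e).length + (cost e).2.1 = e.length := by
  induction e with
  | nil => rfl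
  | cons p e ih =>
    obtain ⟨_ | a, q⟩ := p <;> grind [source, cost]

theorem length_target_add (e : Script A) : (target e).length + (cost e).1 = e.length := by
  simpa [source_map_swap, cost_map_swap] using length_source_add (e.map Prod.swap)

theorem source_eq_target_of_cost_eq_zero {e : Script A} (h : cost e = 0) :
    source e = target e := by
  simp only [cost, Prod.mk_eq_zero, List.countP_eq_zero] at h
  refine List.filterMap_congr fun ⟨a, b⟩ hp => ?_
  have h₁ := h.1 _ hp
  have h₂ := h.2.1 _ hp
  have h₃ := h.2.2 _ hp
  cases a <;> cases b <;> simp_all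

theorem exists_source_target_self (x : List A) :
    ∃ e : Script A, source e = x ∧ target e = x ∧ cost e = 0 :=
  ⟨x.map fun a => (some a, some a), by simp [source, List.filterMap_map],
    by simp [target, List.filterMap_map], by simp [cost, List.countP_map]⟩

/-- An insertion followed by a deletion of the same letter becomes the operation `(none, none)`,
which has the same cost. -/
theorem exists_comp : ∀ e₁ e₂ : Script A, target e₁ = source e₂ →
    ∃ e : Script A, source e = source e₁ ∧ target e = target e₂ ∧ cost e ≤ cost e₁ + cost e₂
  | [], e₂, h => ⟨e₂, h.symm, rfl, by simp [cost]⟩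
  | (p, none) :: e₁, e₂, h => by
    obtain ⟨e, hs, ht, hc⟩ := exists_comp e₁ e₂ h
    refine ⟨(p, none) :: e, ?_, ht, ?_⟩
    · cases p <;> simpa [source] using hs
    · rw [cost_cons, cost_cons (p, none) e₁, add_assoc]
      gcongr
  | (p, some b) :: e₁, (none, q) :: e₂, h => by
    obtain ⟨e, hs, ht, hc⟩ := exists_comp ((p, some b) :: e₁) e₂ h
    refine ⟨(none, q) :: e, hs, ?_, ?_⟩
    · cases q <;> simpa [target] using ht
    · rw [cost_cons, cost_cons (none, q) e₂, add_left_comm]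
      gcongr
  | (p, some b) :: e₁, [], h => by simp [source, target] at h
  | (p, some b) :: e₁, (some c, q) :: e₂, h => by
    obtain ⟨rfl, htail⟩ := List.cons.inj h
    obtain ⟨e, hs, ht, hc⟩ := exists_comp e₁ e₂ htail
    have hstep : cost [(p, q)] ≤ cost [(p, some b)] + cost [(some b, q)] := by
      cases p <;> cases q <;> simp only [cost_insertion, cost_deletion, cost_replacement,
        Prod.mk_add_mk, Prod.mk_le_mk] <;> grind
    refine ⟨(p, q) :: e, ?_, ?_, ?_⟩
    · cases p <;> simpa [source] using hs
    · cases q <;> simpa [target] using ht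
    · rw [cost_cons, cost_cons (p, some b) e₁, cost_cons (some b, q) e₂, add_add_add_comm]
      gcongr
termination_by e₁ e₂ => e₁.length + e₂.length

theorem target_sublist_source {e : Script A} (h : (cost e).2 = 0) :
    (target e).Sublist (source e) := by
  induction e with
  | nil => exact List.Sublist.slnil
  | cons p e ih =>
    rw [cost_cons, Prod.snd_add, add_eq_zero] at h
    obtain ⟨_ | a, _ | b⟩ := p
    · exact ih h.2
    · simp [cost_insertion] at h
    · exact (ih h.2).cons a
    · obtain rfl : a = b := by simpa [cost_replacement, Prod.ext_iff] using h.1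
      exact (ih h.2).cons_cons a

theorem exists_of_sublist {x y : List A} (h : y.Sublist x) :
    ∃ e : Script A, source e = x ∧ target e = y ∧ (cost e).2 = 0 := by
  induction h with
  | slnil => exact ⟨[], rfl, rfl, rfl⟩
  | cons a _ ih =>
    obtain ⟨e, rfl, rfl, he⟩ := ih
    exact ⟨(some a, none) :: e, rfl, rfl, by
      rw [cost_cons, Prod.snd_add, he, cost_deletion]; simp⟩
  | cons_cons a _ ih =>
    obtain ⟨e, rfl, rfl, he⟩ := ih
    exact ⟨(some a, some a) :: e, rfl, rfl, by
      rw [cost_cons, Prod.snd_add, he, cost_replacement]; simp⟩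

theorem ncard_getElem?_cons_ne {a b : A} {x y : List A} (h : x.length = y.length) :
    {i : ℕ | (a :: x)[i]? ≠ (b :: y)[i]?}.ncard =
      {i : ℕ | x[i]? ≠ y[i]?}.ncard + {i : ℕ | i = 0 ∧ a ≠ b}.ncard := by
  have hfin : {i : ℕ | x[i]? ≠ y[i]?}.Finite := by
    refine (Set.finite_lt_nat x.length).subset fun i hi =>
      Set.mem_ofPred.2 (not_le.1 fun hle => hi ?_)
    rw [List.getElem?_eq_none hle, List.getElem?_eq_none (h ▸ hle)]
  have hunion : {i : ℕ | (a :: x)[i]? ≠ (b :: y)[i]?} =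
      Nat.succ '' {i : ℕ | x[i]? ≠ y[i]?} ∪ {i : ℕ | i = 0 ∧ a ≠ b} := by
    ext i
    cases i <;> simp
  have hdisj : Disjoint (Nat.succ '' {i : ℕ | x[i]? ≠ y[i]?}) {i : ℕ | i = 0 ∧ a ≠ b} := by
    rw [Set.disjoint_left]
    rintro _ ⟨i, -, rfl⟩ ⟨h, -⟩
    exact Nat.succ_ne_zero i h
  rw [hunion, Set.ncard_union_eq hdisj (hfin.image _)
      ((Set.finite_singleton 0).subset fun i hi => hi.1),
    Set.ncard_image_of_injective _ Nat.succ_injective]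

theorem ncard_getElem?_source_ne_target {e : Script A} (hd : (cost e).1 = 0)
    (hi : (cost e).2.1 = 0) :
    {i : ℕ | (source e)[i]? ≠ (target e)[i]?}.ncard = (cost e).2.2 := by
  induction e with
  | nil => simp [source, target, cost]
  | cons p e ih =>
    rw [cost_cons] at hd hi ⊢
    simp only [Prod.fst_add, Prod.snd_add, add_eq_zero] at hd hi ⊢
    obtain ⟨_ | a, _ | b⟩ := p
    · simp [cost_insertion] at hi
    · simp [cost_insertion] at hi
    · simp [cost_deletion] at hd
    have hlen : (source e).length = (target e).length := by
      have h₁ := length_source_add e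
      have h₂ := length_target_add e
      omega
    change {i : ℕ | (a :: source e)[i]? ≠ (b :: target e)[i]?}.ncard = _
    rw [ncard_getElem?_cons_ne hlen, ih hd.2 hi.2, add_comm]
    by_cases hab : a = b <;> simp [cost_replacement, hab]

theorem exists_of_length_eq {x y : List A} (h : x.length = y.length) :
    ∃ e : Script A, source e = x ∧ target e = y ∧ (cost e).1 = 0 ∧ (cost e).2.1 = 0 := by
  induction x generalizing y with
  | nil => exact ⟨[], rfl, (List.length_eq_zero_iff.1 h.symm).symm, rfl, rfl⟩
  | cons a x ih =>
    obtain ⟨b, y, rfl⟩ := List.exists_cons_of_length_eq_add_one h.symm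
    obtain ⟨e, rfl, rfl, hd, hi⟩ := ih (Nat.succ_injective h)
    exact ⟨(some a, some b) :: e, rfl, rfl, by rw [cost_cons]; simp [cost_replacement, hd],
      by rw [cost_cons]; simp [cost_replacement, hi]⟩

end Script

/-- The pairs of words that are the source and the target of an edit script whose cost lies
in `C`. -/
def editRel (C : Set (ℕ × ℕ × ℕ)) : WordRel A :=
  {p | ∃ e : Script A, e.source = p.1 ∧ e.target = p.2 ∧ e.cost ∈ C}

theorem editRel_iUnion {ι : Sort*} (C : ι → Set (ℕ × ℕ × ℕ)) :
    (editRel (⋃ i, C i) : WordRel A) = ⋃ i, editRel (C i) := by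
  ext
  simp only [editRel, Set.mem_iUnion, Set.mem_ofPred_eq]
  grind

theorem editRel_union (C D : Set (ℕ × ℕ × ℕ)) :
    (editRel (C ∪ D) : WordRel A) = editRel C ∪ editRel D := by
  simp only [Set.union_eq_iUnion, editRel_iUnion]
  congr! 2 with b
  cases b <;> rfl

theorem del_eq_editRel (k : ℕ) : (WordRel.del k : WordRel A) = editRel {(k, 0, 0)} := by
  ext ⟨x, y⟩
  constructor
  · rintro ⟨hxy, hlen⟩
    obtain ⟨e, rfl, rfl, he⟩ := Script.exists_of_sublist hxy
    refine ⟨e, rfl, rfl, Prod.ext ?_ he⟩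
    have h₁ := e.length_source_add
    have h₂ := e.length_target_add
    simp only [he, Prod.fst_zero] at h₁
    dsimp only at hlen ⊢
    omega
  · rintro ⟨e, rfl, rfl, he⟩
    have h₁ := e.length_source_add
    have h₂ := e.length_target_add
    simp only [Set.mem_singleton_iff.1 he] at h₁ h₂
    exact ⟨Script.target_sublist_source (by rw [Set.mem_singleton_iff.1 he]; rfl), h₂.trans h₁.symm⟩

theorem ins_eq_editRel (k : ℕ) : (WordRel.ins k : WordRel A) = editRel {(0, k, 0)} := by
  ext ⟨x, y⟩
  rw [WordRel.ins, del_eq_editRel]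
  constructor <;> rintro ⟨e, hs, ht, he⟩ <;>
    exact ⟨e.map Prod.swap, by rwa [Script.source_map_swap], by rwa [Script.target_map_swap],
      by rw [Script.cost_map_swap, Set.mem_singleton_iff.1 he]; rfl⟩

theorem sub_eq_editRel (k : ℕ) : (WordRel.sub k : WordRel A) = editRel {(0, 0, k)} := by
  ext ⟨x, y⟩
  constructor
  · rintro ⟨hlen, hk⟩
    obtain ⟨e, rfl, rfl, hd, hi⟩ := Script.exists_of_length_eq hlen
    exact ⟨e, rfl, rfl, Prod.ext hd
      (Prod.ext hi ((Script.ncard_getElem?_source_ne_target hd hi).symm.trans hk))⟩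
  · rintro ⟨e, rfl, rfl, he⟩
    have h₁ := e.length_source_add
    have h₂ := e.length_target_add
    have h₃ := Script.ncard_getElem?_source_ne_target (e := e)
    simp only [Set.mem_singleton_iff.1 he, forall_const] at h₁ h₂ h₃
    exact ⟨h₁.trans h₂.symm, h₃⟩

/-- The total number of edit operations that a cost stands for. -/
def total (c : ℕ × ℕ × ℕ) : ℕ := c.1 + c.2.1 + c.2.2

theorem total_add (c d : ℕ × ℕ × ℕ) : total (c + d) = total c + total d := by
  simp only [total, Prod.fst_add, Prod.snd_add]
  omega

theorem total_mono {c d : ℕ × ℕ × ℕ} (h : c ≤ d) : total c ≤ total d :=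
  add_le_add (add_le_add h.1 h.2.1) h.2.2

theorem total_cost_singleton {p : Option A × Option A}
    (h : Script.source [p] ≠ Script.target [p]) : total (Script.cost [p]) = 1 := by
  obtain ⟨_ | a, _ | b⟩ := p
  · exact absurd rfl h
  · simp [Script.cost_insertion, total]
  · simp [Script.cost_deletion, total]
  · have hab : a ≠ b := by simpa [Script.source, Script.target] using h
    simp [Script.cost_replacement, total, hab]

theorem append_mem_pow_editRel {C : Set (ℕ × ℕ × ℕ)} {n : ℕ} {x y : List A}
    (h : (x, y) ∈ WordRel.pow (editRel C) n) (u : List A) :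
    (u ++ x, u ++ y) ∈ WordRel.pow (editRel C) n := by
  induction n generalizing y with
  | zero => exact congrArg (u ++ ·) h
  | succ n ih =>
    obtain ⟨_, hz, e, rfl, rfl, he⟩ := h
    obtain ⟨e₀, h₁, h₂, h₀⟩ := Script.exists_source_target_self u
    exact ⟨_, ih hz, e₀ ++ e, by rw [Script.source_append, h₁],
      by rw [Script.target_append, h₂], by rwa [Script.cost_append, h₀, zero_add]⟩

variable (D : AddSubmonoid (ℕ × ℕ × ℕ))

theorem exists_mem_pow_of_cost_mem (hD : IsLowerSet (D : Set (ℕ × ℕ × ℕ)))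
    (e : Script A) (he : e.cost ∈ D) :
    ∃ n ≤ total e.cost,
      (e.source, e.target) ∈ WordRel.pow (editRel {c | c ∈ D ∧ total c = 1}) n := by
  induction e with
  | nil => exact ⟨0, Nat.zero_le _, rfl⟩
  | cons p e ih =>
    rw [Script.cost_cons] at he ⊢
    obtain ⟨n, hn, hmem⟩ := ih (hD le_add_self he)
    have hcons := append_mem_pow_editRel hmem (Script.source [p])
    rw [← Script.source_append, List.singleton_append] at hcons
    rw [total_add]
    by_cases hp : Script.source [p] = Script.target [p]
    · refine ⟨n, le_add_left hn, ?_⟩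
      rwa [hp, ← Script.target_append] at hcons
    · refine ⟨n + 1, by rw [total_cost_singleton hp]; omega, _, hcons, ?_⟩
      obtain ⟨e₀, h₁, h₂, h₀⟩ := Script.exists_source_target_self (Script.target e)
      refine ⟨[p] ++ e₀, by rw [Script.source_append, h₁], ?_, ?_⟩
      · rw [Script.target_append, h₂, ← Script.target_append]
        rfl
      · rw [Script.cost_append, h₀, add_zero]
        exact ⟨hD le_self_add he, total_cost_singleton hp⟩

theorem pow_editRel_subset (hD : IsLowerSet (D : Set (ℕ × ℕ × ℕ))) (n : ℕ) :
    (WordRel.pow (editRel {c | c ∈ D ∧ total c = 1}) n : WordRel A) ⊆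
      editRel {c | c ∈ D ∧ total c ≤ n} := by
  induction n with
  | zero =>
    rintro ⟨x, _⟩ rfl
    obtain ⟨e, h₁, h₂, h₀⟩ := Script.exists_source_target_self x
    exact ⟨e, h₁, h₂, by rw [h₀]; exact ⟨D.zero_mem, le_rfl⟩⟩
  | succ n ih =>
    rintro ⟨x, z⟩ ⟨y, hxy, e₂, h₂, rfl, hc₂, ht₂⟩
    obtain ⟨e₁, rfl, h₁, hc₁, ht₁⟩ := ih hxy
    obtain ⟨e, hs, ht, hle⟩ := Script.exists_comp e₁ e₂ (h₁.trans h₂.symm)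
    refine ⟨e, hs, ht, hD hle (D.add_mem hc₁ hc₂), (total_mono hle).trans ?_⟩
    rw [total_add, ht₂]
    exact Nat.succ_le_succ ht₁

theorem antirefl_iUnion_pow_editRel (hD : IsLowerSet (D : Set (ℕ × ℕ × ℕ))) (p : ℕ) :
    WordRel.antirefl (⋃ k ∈ Set.Icc 1 p, WordRel.pow (editRel {c | c ∈ D ∧ total c = 1}) k :
      WordRel A) = (editRel {c | c ∈ D ∧ total c ≤ p}).antirefl := by
  ext ⟨x, y⟩
  refine and_congr_left fun hne => ⟨fun h => ?_, ?_⟩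
  · obtain ⟨k, hk, hxy⟩ := Set.mem_iUnion₂.1 h
    obtain ⟨e, hs, ht, hc, hle⟩ := pow_editRel_subset D hD k hxy
    exact ⟨e, hs, ht, hc, hle.trans hk.2⟩
  · rintro ⟨e, rfl, rfl, hc, hle⟩
    obtain ⟨n, hn, hmem⟩ := exists_mem_pow_of_cost_mem D hD e hc
    have hn₀ : n ≠ 0 := by
      rintro rfl
      exact hne hmem
    exact Set.mem_iUnion₂.2 ⟨n, ⟨Nat.one_le_iff_ne_zero.2 hn₀, hn.trans hle⟩, hmem⟩

theorem antirefl_lev (p : ℕ) :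
    (WordRel.lev p : WordRel A).antirefl = (editRel {c | total c ≤ p}).antirefl := by
  have hC : ({(1, 0, 0)} ∪ {(0, 1, 0)} ∪ {(0, 0, 1)} : Set (ℕ × ℕ × ℕ)) =
      {c | c ∈ (⊤ : AddSubmonoid (ℕ × ℕ × ℕ)) ∧ total c = 1} := by
    ext ⟨d, i, s⟩
    simp only [Set.mem_union, Set.mem_singleton_iff, Prod.mk.injEq, Set.mem_ofPred_eq,
      AddSubmonoid.mem_top, true_and, total]
    omega
  rw [WordRel.lev, del_eq_editRel, ins_eq_editRel, sub_eq_editRel, ← editRel_union,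
    ← editRel_union, hC, antirefl_iUnion_pow_editRel ⊤ isLowerSet_univ]
  simp only [AddSubmonoid.mem_top, true_and]

theorem antirefl_indel (p : ℕ) :
    (WordRel.indel p : WordRel A).antirefl =
      (editRel {c | c.2.2 = 0 ∧ total c ≤ p}).antirefl := by
  have hC : ({(1, 0, 0)} ∪ {(0, 1, 0)} : Set (ℕ × ℕ × ℕ)) =
      {c | c ∈ AddMonoidHom.mker ((AddMonoidHom.snd ℕ ℕ).comp (.snd ℕ (ℕ × ℕ))) ∧
        total c = 1} := by
    ext ⟨d, i, s⟩
    simp only [Set.mem_union, Set.mem_singleton_iff, Prod.mk.injEq, Set.mem_ofPred_eq,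
      AddMonoidHom.mem_mker, AddMonoidHom.comp_apply, AddMonoidHom.coe_snd, total]
    omega
  rw [WordRel.indel, del_eq_editRel, ins_eq_editRel, ← editRel_union, hC,
    antirefl_iUnion_pow_editRel _ fun c d hdc hc => ?_]
  · rfl
  · exact Nat.le_zero.1 (hdc.2.2.trans_eq hc)

end EditScripts

section ImageIndex

variable {A : Type*}

/-- The letters by which one of the words `x` and `u` exceeds the other, and whether one of them is
a prefix of the other; the lengths are supposed to differ by at most `K`. -/
def offset (K : ℕ) (x u : List A) : (Fin K → Option A) × (Fin K → Option A) × Prop :=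
  (fun j => (x.drop u.length)[(j : ℕ)]?, fun j => (u.drop x.length)[(j : ℕ)]?, x <+: u ∨ u <+: x)

theorem append_eq_append_iff_drop {x u p q : List A} (h : x <+: u ∨ u <+: x) :
    x ++ p = u ++ q ↔ x.drop u.length ++ p = u.drop x.length ++ q := by
  rcases h with ⟨e, rfl⟩ | ⟨e, rfl⟩ <;> simp [List.drop_eq_nil_of_le]

theorem eq_of_getElem?_fin {K : ℕ} {x y : List A} (hx : x.length ≤ K) (hy : y.length ≤ K)
    (h : ∀ j : Fin K, x[(j : ℕ)]? = y[(j : ℕ)]?) : x = y := by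
  refine List.ext_getElem? fun j => ?_
  by_cases hj : j < K
  · exact h ⟨j, hj⟩
  · rw [List.getElem?_eq_none (by omega), List.getElem?_eq_none (by omega)]

theorem append_eq_append_of_offset_eq {K : ℕ} {x u x' u' p q : List A}
    (hx : x.length ≤ u.length + K) (hu : u.length ≤ x.length + K)
    (hx' : x'.length ≤ u'.length + K) (hu' : u'.length ≤ x'.length + K)
    (h : offset K x u = offset K x' u') (heq : x ++ p = u ++ q) : x' ++ p = u' ++ q := by
  have hcomp : x <+: u ∨ u <+: x :=
    List.prefix_or_prefix_of_prefix ⟨p, rfl⟩ ⟨q, heq.symm⟩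
  simp only [offset, Prod.mk.injEq, funext_iff, eq_iff_iff] at h
  obtain ⟨hdrop, hdrop', hcomp'⟩ := h
  rw [append_eq_append_iff_drop hcomp] at heq
  rw [append_eq_append_iff_drop (hcomp'.1 hcomp)]
  rwa [← eq_of_getElem?_fin (by simp; omega) (by simp; omega) hdrop,
    ← eq_of_getElem?_fin (by simp; omega) (by simp; omega) hdrop']

theorem Script.exists_of_source_eq_append {e : Script A} {u v : List A}
    (h : e.source = u ++ v) : ∃ e₁ e₂ : Script A, e = e₁ ++ e₂ ∧ e₁.source = u ∧ e₂.source = v :=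
  List.filterMap_eq_append_iff.1 h

theorem Script.exists_of_target_eq_append {e : Script A} {u v : List A}
    (h : e.target = u ++ v) : ∃ e₁ e₂ : Script A, e = e₁ ++ e₂ ∧ e₁.target = u ∧ e₂.target = v :=
  List.filterMap_eq_append_iff.1 h

theorem total_eq_zero {c : ℕ × ℕ × ℕ} : total c = 0 ↔ c = 0 := by
  simp only [total, Prod.ext_iff, Prod.fst_zero, Prod.snd_zero]
  omega

theorem le_of_total_le {c : ℕ × ℕ × ℕ} {K : ℕ} (h : total c ≤ K) : c ≤ (K, K, K) := by
  simp only [total] at h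
  exact ⟨by dsimp only; omega, by dsimp only; omega, by dsimp only; omega⟩

theorem Script.length_source_le {e : Script A} {K : ℕ} (h : e.cost ≤ (K, K, K)) :
    e.source.length ≤ e.target.length + K := by
  have h₁ := e.length_source_add
  have h₂ := e.length_target_add
  have hd : e.cost.1 ≤ K := h.1
  omega

theorem Script.length_target_le {e : Script A} {K : ℕ} (h : e.cost ≤ (K, K, K)) :
    e.target.length ≤ e.source.length + K := by
  have h₁ := e.length_source_add
  have h₂ := e.length_target_add
  have hi : e.cost.2.1 ≤ K := h.2.1
  omega

/-- The class of `u` for the image of `X` is determined by the scripts that produce `u`, through the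
class of their source for `X`, their cost, and the offset of their source from `u`. The offset is
what it takes to exclude the pairs of equal words. -/
theorem HasIndex.image_antirefl_editRel [Finite A] {X : Language A} {n : ℕ} (hX : HasIndex X n)
    {C : Set (ℕ × ℕ × ℕ)} {K : ℕ} (hC : ∀ c ∈ C, total c ≤ K) :
    HasIndex ((editRel C).antirefl.image X)
      (2 ^ (n * (((K + 1) * ((K + 1) * (K + 1))) *
        ((Nat.card A + 1) ^ K * ((Nat.card A + 1) ^ K * 2))))) := by
  obtain ⟨φ, hφ⟩ := hX.exists_map
  have hindex := HasIndex.of_finite (L := (editRel C).antirefl.image X)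
    (fun u => ({f | ∃ e : Script A, e.target = u ∧ φ e.source = f.1 ∧ e.cost = f.2.1 ∧
      offset K e.source u = f.2.2} : Set (Fin n × Set.Iic (K, K, K) ×
        ((Fin K → Option A) × (Fin K → Option A) × Prop)))) ?_
  · have := Fintype.ofFinite A
    classical
    simpa [Nat.card_eq_fintype_card, ← Finset.Iic_product_Iic] using hindex
  rintro u u' v h ⟨x, hx, ⟨e, rfl, he, hc⟩, hne⟩
  obtain ⟨e₁, e₂, rfl, rfl, rfl⟩ := Script.exists_of_target_eq_append he
  rw [Script.source_append] at hx hne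
  rw [Script.cost_append] at hc
  have hc₁ : e₁.cost ≤ (K, K, K) := le_self_add.trans (le_of_total_le (hC _ hc))
  obtain ⟨e₁', rfl, hφ', hcost, hoffset⟩ := (Set.ext_iff.1 h
    (φ e₁.source, ⟨e₁.cost, hc₁⟩, offset K e₁.source e₁.target)).1 ⟨e₁, rfl, rfl, rfl, rfl⟩
  dsimp only at hφ' hcost hoffset
  have hc₁' : e₁'.cost ≤ (K, K, K) := hcost ▸ hc₁
  refine ⟨_, hφ _ _ _ hφ'.symm hx, ⟨e₁' ++ e₂, Script.source_append _ _,
    Script.target_append _ _, by rwa [Script.cost_append, hcost]⟩, fun heq => hne ?_⟩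
  exact append_eq_append_of_offset_eq (Script.length_source_le hc₁')
    (Script.length_target_le hc₁') (Script.length_source_le hc₁) (Script.length_target_le hc₁)
    hoffset heq

end ImageIndex

section Extension

variable {A : Type*}

/-- No nonempty proper prefix of `z` is a suffix of `z`. -/
def Unbordered (z : List A) : Prop := ∀ g, g <+: z → g <:+ z → g = [] ∨ g = z

theorem Unbordered.length_le {z : List A} (hz : Unbordered z) {p q r t : List A}
    (hq : ∀ u v, q ≠ u ++ z ++ v) (h : p ++ (z ++ r) = q ++ (z ++ t)) : q.length ≤ p.length := by
  by_contra! hlt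
  obtain ⟨e, rfl⟩ := List.prefix_of_prefix_length_le ⟨_, h⟩ (List.prefix_append q _) hlt.le
  have hzr : z ++ r = e ++ (z ++ t) := by simpa using h
  rcases List.prefix_or_prefix_of_prefix ⟨_, hzr⟩ (List.prefix_append e _) with ⟨f, rfl⟩ | ⟨g, hg⟩
  · exact hq p f (by simp)
  have hgr : g ++ r = z ++ t := by simpa [← hg] using hzr
  have hzpre : g <+: z := List.prefix_of_prefix_length_le ⟨_, hgr⟩ (List.prefix_append z _)
    (by simp [← hg])
  rcases hz g hzpre ⟨e, hg⟩ with rfl | rfl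
  · exact hq p [] (by simpa using hg)
  · obtain rfl : e = [] := by simpa using hg
    simp at hlt

theorem forall_mem_of_insert {X : Set (List A)} {z : List A} {P : List (List A)}
    (hP : ∀ x ∈ P, x ∈ insert z X) (hz : z ∉ P) : ∀ x ∈ P, x ∈ X :=
  fun x hx => (hP x hx).resolve_left fun h => hz (h ▸ hx)

theorem uniquelyDecodable_insert {X : Language A} (hX : UniquelyDecodable X) {z : List A}
    (hz : z ∉ factors X∗) (hub : Unbordered z) : UniquelyDecodable (insert z X) := by
  have hfactor : ∀ P : List (List A), (∀ x ∈ P, x ∈ X) → ∀ u v, P.flatten ≠ u ++ z ++ v :=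
    fun P hP u v h => hz ⟨u, v, h ▸ Language.join_mem_kstar hP⟩
  intro L K hL hK h
  induction hn : L.length using Nat.strong_induction_on generalizing L K with
  | _ n ih =>
    by_cases hzL : z ∈ L <;> by_cases hzK : z ∈ K
    · obtain ⟨P, R, rfl, hzP⟩ := List.eq_append_cons_of_mem hzL
      obtain ⟨Q, T, rfl, hzQ⟩ := List.eq_append_cons_of_mem hzK
      simp only [List.mem_append, List.mem_cons, or_imp, forall_and] at hL hK
      have hP := forall_mem_of_insert hL.1 hzP
      have hQ := forall_mem_of_insert hK.1 hzQ
      simp only [List.flatten_append, List.flatten_cons] at h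
      have hlen : P.flatten.length = Q.flatten.length :=
        le_antisymm (hub.length_le (hfactor P hP) h.symm) (hub.length_le (hfactor Q hQ) h)
      obtain ⟨hPQ, hRT⟩ := List.append_inj h hlen
      rw [hX P Q hP hQ hPQ, ih R.length (by grind) R T hL.2.2 hK.2.2
        (List.append_cancel_left hRT) rfl]
    · obtain ⟨P, R, rfl, -⟩ := List.eq_append_cons_of_mem hzL
      exact absurd (by simpa using h.symm)
        (hfactor K (forall_mem_of_insert hK hzK) P.flatten R.flatten)
    · obtain ⟨Q, T, rfl, -⟩ := List.eq_append_cons_of_mem hzK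
      exact absurd (by simpa using h) (hfactor L (forall_mem_of_insert hL hzL) Q.flatten T.flatten)
    · exact hX L K (forall_mem_of_insert hL hzL) (forall_mem_of_insert hK hzK) h

theorem unbordered_cons_append_replicate {a b : A} (hab : a ≠ b) (v : List A) :
    Unbordered (a :: v ++ List.replicate (v.length + 1) b) := by
  classical
  rintro g hgz ⟨s, hs⟩
  by_contra! hg
  obtain ⟨a', g', rfl⟩ := List.exists_cons_of_ne_nil hg.1
  obtain rfl : a' = a := (List.cons_prefix_cons.1 hgz).1
  have hs₀ : s ≠ [] := by
    rintro rfl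
    exact hg.2 hs
  obtain ⟨a'', s', rfl⟩ := List.exists_cons_of_ne_nil hs₀
  obtain rfl : a'' = a' := (List.cons.inj hs).1
  have hcount : (a'' :: g').count a'' < (a'' :: v).count a'' := by
    have h := congrArg (List.count a'') hs
    rw [List.count_append, List.count_append, List.count_replicate,
      if_neg (by simpa using hab.symm), List.count_cons_self] at h
    omega
  have hshort : (a'' :: g').length ≤ v.length + 1 := by
    by_contra! hlong
    exact hcount.not_ge ((List.prefix_of_prefix_length_le (List.prefix_append _ _) hgz
      hlong.le).sublist.count_le _)
  have hsuffix : a'' :: g' <:+ List.replicate (v.length + 1) b :=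
    List.suffix_of_suffix_length_le ⟨_, hs⟩ (List.suffix_append _ _) (by simpa using hshort)
  exact hab (List.eq_of_mem_replicate (hsuffix.subset List.mem_cons_self))

/-- Too few edits cannot touch all the blocks of a power. -/
theorem Script.exists_target_eq_append {w r : List A} {m : ℕ} {e : Script A}
    (hs : e.source = (List.replicate m w).flatten ++ r) (hc : total e.cost < m) :
    ∃ p q, e.target = p ++ w ++ q := by
  induction m generalizing e with
  | zero => exact absurd hc (Nat.not_lt_zero _)
  | succ m ih =>
    rw [List.replicate_succ, List.flatten_cons, List.append_assoc] at hs
    obtain ⟨e₁, e₂, rfl, rfl, hs₂⟩ := Script.exists_of_source_eq_append hs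
    rw [Script.cost_append, total_add] at hc
    rw [Script.target_append]
    by_cases h₁ : e₁.cost = 0
    · exact ⟨[], e₂.target, by rw [Script.source_eq_target_of_cost_eq_zero h₁, List.nil_append]⟩
    · have hpos : 0 < total e₁.cost := Nat.pos_of_ne_zero fun h => h₁ (total_eq_zero.1 h)
      obtain ⟨p, q, hpq⟩ := ih hs₂ (by omega)
      exact ⟨e₁.target ++ p, q, by simp [hpq]⟩

theorem not_mem_of_mem_editRel {X : Language A} {w : List A} (hw : w ∉ factors X∗)
    {C : Set (ℕ × ℕ × ℕ)} {K : ℕ} (hC : ∀ c ∈ C, total c ≤ K) {z y : List A}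
    (hz : (List.replicate (K + 1) w).flatten <+: z)
    (hzy : (z, y) ∈ editRel C ∨ (y, z) ∈ editRel C) : y ∉ X := by
  obtain ⟨r, rfl⟩ := hz
  obtain ⟨e, hs, rfl, hc⟩ : ∃ e : Script A,
      e.source = (List.replicate (K + 1) w).flatten ++ r ∧ e.target = y ∧ total e.cost ≤ K := by
    rcases hzy with ⟨e, hs, ht, hc⟩ | ⟨e, hs, ht, hc⟩
    · exact ⟨e, hs, ht, hC _ hc⟩
    · refine ⟨e.map Prod.swap, by rwa [Script.source_map_swap], by rwa [Script.target_map_swap],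
        ?_⟩
      rw [Script.cost_map_swap, total, add_comm (Prod.fst _)]
      exact hC _ hc
  obtain ⟨p, q, hpq⟩ := Script.exists_target_eq_append hs (Nat.lt_succ_of_le hc)
  exact fun hy => hw ⟨p, q, le_kstar (a := X) (hpq ▸ hy)⟩

theorem independent_insert {τ : WordRel A} {X : Set (List A)} {z : List A}
    (hX : τ.Independent X) (hzz : (z, z) ∉ τ)
    (hz : ∀ x ∈ X, (z, x) ∉ τ ∧ (x, z) ∉ τ) : τ.Independent (insert z X) := by
  rw [WordRel.Independent, Set.eq_empty_iff_forall_notMem] at hX ⊢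
  rintro y ⟨⟨x, rfl | hx, hxy⟩, rfl | hy⟩
  · exact hzz hxy
  · exact (hz y hy).1 hxy
  · exact (hz x hx).2 hxy
  · exact hX y ⟨⟨x, hx, hxy⟩, hy⟩

/-- The new word starts with so many copies of a word which is not a factor of `X∗` that the edits
leave one of them intact, and is padded to become unbordered. -/
theorem exists_insert_of_not_complete [Nontrivial A] {X : Language A}
    (hX : UniquelyDecodable X) (hcompl : ¬ Complete X) {C : Set (ℕ × ℕ × ℕ)} {K : ℕ}
    (hC : ∀ c ∈ C, total c ≤ K) (hind : (editRel C).antirefl.Independent X) :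
    ∃ z ∉ X, UniquelyDecodable (insert z X) ∧
      (editRel C).antirefl.Independent (insert z X) := by
  obtain ⟨w, hw⟩ := not_forall.1 hcompl
  obtain _ | ⟨a, w⟩ := w
  · exact absurd ⟨[], [], Language.nil_mem_kstar X⟩ hw
  obtain ⟨b, hba⟩ := exists_ne a
  obtain ⟨v, hv⟩ : ∃ v, (List.replicate (K + 1) (a :: w)).flatten = a :: v :=
    ⟨w ++ (List.replicate K (a :: w)).flatten, by simp [List.replicate_succ]⟩
  set z := a :: v ++ List.replicate (v.length + 1) b
  have hzpre : (List.replicate (K + 1) (a :: w)).flatten <+: z := ⟨_, by rw [hv]⟩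
  have hfactor : z ∉ factors X∗ := by
    rintro ⟨p, q, hpq⟩
    obtain ⟨r, hr⟩ := hzpre
    rw [← hr, List.replicate_succ, List.flatten_cons] at hpq
    exact hw ⟨p, (List.replicate K (a :: w)).flatten ++ (r ++ q), by simpa using hpq⟩
  have hzX : z ∉ X := fun h => hfactor
    ⟨[], [], by rw [List.nil_append, List.append_nil]; exact le_kstar (a := X) h⟩
  refine ⟨z, hzX,
    uniquelyDecodable_insert hX hfactor (unbordered_cons_append_replicate hba.symm v),
    independent_insert hind (fun h => h.2 rfl) fun x hx => ⟨fun h => ?_, fun h => ?_⟩⟩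
  · exact not_mem_of_mem_editRel hw hC hzpre (Or.inl h.1) hx
  · exact not_mem_of_mem_editRel hw hC hzpre (Or.inr h.1) hx

end Extension

section Weight

open scoped ENNReal

variable {A : Type*}

/-- The weight of a word under the uniform Bernoulli distribution. -/
noncomputable def weight (w : List A) : ℝ≥0∞ := (Nat.card A : ℝ≥0∞)⁻¹ ^ w.length

/-- The total weight of the words of a language. -/
noncomputable def totalWeight (L : Language A) : ℝ≥0∞ := ∑' w : {w | w ∈ L}, weight w.1

theorem weight_append (u v : List A) : weight (u ++ v) = weight u * weight v := by
  simp [weight, pow_add]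

theorem weight_ne_zero (w : List A) : weight w ≠ 0 := by
  simp [weight]

theorem totalWeight_mul_le (L M : Language A) :
    totalWeight (L * M) ≤ totalWeight L * totalWeight M := by
  let f : {w | w ∈ L} × {w | w ∈ M} → {w | w ∈ L * M} :=
    fun p => ⟨p.1.1 ++ p.2.1, Language.append_mem_mul p.1.2 p.2.2⟩
  have hf : Function.Surjective f := by
    rintro ⟨_, u, hu, v, hv, rfl⟩
    exact ⟨(⟨u, hu⟩, ⟨v, hv⟩), rfl⟩
  calc totalWeight (L * M)
      ≤ ∑' p, weight (f p).1 :=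
        ENNReal.tsum_le_tsum_comp_of_surjective hf fun w => weight w.1
    _ = totalWeight L * totalWeight M := by
        simp only [f, weight_append, ENNReal.tsum_prod', ENNReal.tsum_mul_left,
          ENNReal.tsum_mul_right, totalWeight]

theorem totalWeight_pow_le (L : Language A) (n : ℕ) :
    totalWeight (L ^ n) ≤ totalWeight L ^ n := by
  induction n with
  | zero =>
    rw [pow_zero, pow_zero]
    exact ((tsum_singleton [] weight).trans (by simp [weight])).le
  | succ n ih =>
    rw [pow_succ, pow_succ]
    exact (totalWeight_mul_le _ _).trans (by gcongr)

theorem totalWeight_kstar_le (L : Language A) :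
    totalWeight L∗ ≤ ∑' n : ℕ, totalWeight L ^ n := by
  have hstar : {w | w ∈ L∗} = ⋃ n : ℕ, {w | w ∈ L ^ n} := by
    ext w
    simp [Language.kstar_eq_iSup_pow, Language.mem_iSup]
  rw [totalWeight, hstar]
  exact (ENNReal.tsum_iUnion_le_tsum _ _).trans
    (ENNReal.tsum_le_tsum fun n => totalWeight_pow_le L n)

theorem totalWeight_kstar_ne_top {L : Language A} (hL : totalWeight L < 1) :
    totalWeight L∗ ≠ ∞ := by
  refine ne_top_of_le_ne_top ?_ (totalWeight_kstar_le L)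
  rw [ENNReal.tsum_geometric, ENNReal.inv_ne_top]
  exact (tsub_pos_of_lt hL).ne'

theorem totalWeight_leftQuotient_ne_top {L : Language A} (hL : totalWeight L ≠ ∞) (u : List A) :
    totalWeight (L.leftQuotient u) ≠ ∞ := by
  have hle : weight u * totalWeight (L.leftQuotient u) ≤ totalWeight L := by
    rw [totalWeight, ← ENNReal.tsum_mul_left]
    simp only [← weight_append]
    exact ENNReal.tsum_comp_le_tsum_of_injective
      (f := fun v : {v | v ∈ L.leftQuotient u} => (⟨u ++ v.1, v.2⟩ : {w | w ∈ L}))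
      (fun v v' h => Subtype.ext (List.append_cancel_left (Subtype.ext_iff.1 h)))
      fun w => weight w.1
  exact fun h => hL (top_le_iff.1 (by rwa [h, ENNReal.mul_top (weight_ne_zero u)] at hle))

theorem totalWeight_rightQuotient_singleton_ne_top {L : Language A} (hL : totalWeight L ≠ ∞)
    (v : List A) : totalWeight (rightQuotient L {v}) ≠ ∞ := by
  have hle : totalWeight (rightQuotient L {v}) * weight v ≤ totalWeight L := by
    rw [totalWeight, ← ENNReal.tsum_mul_right]
    simp only [← weight_append]
    exact ENNReal.tsum_comp_le_tsum_of_injective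
      (f := fun u : {u | u ∈ rightQuotient L {v}} =>
        (⟨u.1 ++ v, by obtain ⟨_, rfl, h⟩ := u.2; exact h⟩ : {w | w ∈ L}))
      (fun u u' h => Subtype.ext (List.append_cancel_right (Subtype.ext_iff.1 h)))
      fun w => weight w.1
  exact fun h => hL (top_le_iff.1 (by rwa [h, ENNReal.top_mul (weight_ne_zero v)] at hle))

theorem totalWeight_ne_top_of_subset_biUnion {L : Language A} {ι : Type*} {I : Set ι}
    (hI : I.Finite) {M : ι → Language A} (hL : ∀ w ∈ L, ∃ i ∈ I, w ∈ M i)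
    (hM : ∀ i ∈ I, totalWeight (M i) ≠ ∞) : totalWeight L ≠ ∞ := by
  have hsub : {w | w ∈ L} ⊆ ⋃ i ∈ hI.toFinset, {w | w ∈ M i} := fun w hw => by
    simpa using hL w hw
  refine ne_top_of_le_ne_top (ENNReal.sum_ne_top.2 fun i hi => hM i (hI.mem_toFinset.1 hi))
    ((ENNReal.tsum_mono_subtype weight hsub).trans (ENNReal.tsum_biUnion_le weight _ _))

/-- Every factor of a word of a regular language extends to a word of the language by one of
finitely many words on the right, and has one of finitely many left contexts up to equivalence. -/
theorem totalWeight_factors_ne_top [Finite A] {L : Language A} {n : ℕ} (hn : HasIndex L n)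
    (hL : totalWeight L ≠ ∞) : totalWeight (factors L) ≠ ∞ := by
  have hprefixes : totalWeight (rightQuotient L ⊤) ≠ ∞ := by
    refine totalWeight_ne_top_of_subset_biUnion (List.finite_length_lt A n)
      (M := fun v => rightQuotient L {v}) (fun u ⟨v, _, huv⟩ => ?_)
      fun v _ => totalWeight_rightQuotient_singleton_ne_top hL v
    obtain ⟨v', hv', hlt⟩ := (hn.leftQuotient u).exists_length_lt ⟨v, huv⟩
    exact ⟨v', hlt, v', rfl, hv'⟩
  refine totalWeight_ne_top_of_subset_biUnion
    (Set.finite_of_encard_le_coe (hn.rightQuotient ⊤)) (M := id) ?_ ?_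
  · rintro w ⟨u, v, huv⟩
    exact ⟨_, ⟨u, rfl⟩, v, trivial, huv⟩
  · rintro _ ⟨u, rfl⟩
    exact totalWeight_leftQuotient_ne_top hprefixes u

variable [Finite A] [Nonempty A]

theorem totalWeight_le_one {X : Language A} (hX : UniquelyDecodable X) : totalWeight X ≤ 1 := by
  classical
  have := Fintype.ofFinite A
  rw [totalWeight, ENNReal.tsum_eq_iSup_sum]
  refine iSup_le fun T => ?_
  have hT : UniquelyDecodable
      ((T.map (Function.Embedding.subtype _) : Finset (List A)) : Set (List A)) := by
    refine uniquelyDecodable_mono (fun w hw => ?_) hX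
    obtain ⟨w, -, rfl⟩ := Finset.mem_map.1 hw
    exact w.2
  have hkraft := kraft_mcmillan_inequality hT
  rw [Finset.sum_map] at hkraft
  have hweight (w : List A) :
      weight w = ENNReal.ofReal ((1 / Fintype.card A : ℝ) ^ w.length) := by
    have hpos : (0 : ℝ) < Fintype.card A := by exact_mod_cast Fintype.card_pos
    rw [weight, ENNReal.ofReal_pow (by positivity), one_div, ENNReal.ofReal_inv_of_pos hpos,
      ENNReal.ofReal_natCast, Nat.card_eq_fintype_card]
  simp only [hweight]
  rw [← ENNReal.ofReal_sum_of_nonneg fun _ _ => by positivity]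
  exact ENNReal.ofReal_le_one.2 hkraft

theorem totalWeight_lt_one_of_insert {X : Language A} {z : List A} (hz : z ∉ X)
    (h : UniquelyDecodable (insert z X)) : totalWeight X < 1 := by
  have hinsert : weight z + totalWeight X ≤ 1 := by
    refine le_trans (le_of_eq ?_) (totalWeight_le_one (X := insert z X) h)
    rw [totalWeight, totalWeight, ← tsum_singleton z weight]
    exact (ENNReal.summable.tsum_union_disjoint (by simpa using hz) ENNReal.summable).symm
  have htop : totalWeight X ≠ ∞ :=
    ne_top_of_le_ne_top ENNReal.one_ne_top (le_add_self.trans hinsert)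
  calc totalWeight X < totalWeight X + weight z := ENNReal.lt_add_right htop (weight_ne_zero z)
    _ ≤ 1 := by rwa [add_comm]

theorem totalWeight_top : totalWeight (⊤ : Language A) = ∞ := by
  have := Fintype.ofFinite A
  have hcard : (Fintype.card A : ℝ≥0∞) ≠ 0 := by exact_mod_cast Fintype.card_pos.ne'
  have hlength (n : ℕ) : ∑' f : Fin n → A, weight (List.equivSigmaTuple.symm ⟨n, f⟩) = 1 := by
    rw [tsum_fintype]
    simp only [List.equivSigmaTuple, Equiv.coe_fn_symm_mk, weight, List.length_ofFn,
      Nat.card_eq_fintype_card, Finset.sum_const, Finset.card_univ, Fintype.card_fun,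
      Fintype.card_fin, nsmul_eq_mul, Nat.cast_pow]
    rw [← mul_pow, ENNReal.mul_inv_cancel hcard (by simp), one_pow]
  calc totalWeight (⊤ : Language A) = ∑' w : List A, weight w := tsum_univ weight
    _ = ∑' n : ℕ, ∑' f : Fin n → A, weight (List.equivSigmaTuple.symm ⟨n, f⟩) := by
        rw [← List.equivSigmaTuple.symm.tsum_eq, ENNReal.tsum_sigma']
    _ = ∞ := by
        simp only [hlength]
        exact ENNReal.tsum_const_eq_top_of_ne_zero one_ne_zero

theorem not_uniquelyDecodable_insert_of_complete {X : Language A} {n : ℕ} (hn : HasIndex X n)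
    (hcompl : Complete X) {z : List A} (hz : z ∉ X) : ¬ UniquelyDecodable (insert z X) := by
  intro h
  have hfactors := totalWeight_factors_ne_top hn.kstar
    (totalWeight_kstar_ne_top (totalWeight_lt_one_of_insert hz h))
  rw [(Set.eq_univ_of_forall hcompl : factors X∗ = (⊤ : Language A))] at hfactors
  exact hfactors totalWeight_top

end Weight

theorem maximalIndependentCode_iff {A : Type*} [Finite A] [Nontrivial A] {X : Language A}
    {n : ℕ} (hn : HasIndex X n) {C : Set (ℕ × ℕ × ℕ)} {K : ℕ} (hC : ∀ c ∈ C, total c ≤ K) :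
    (editRel C).antirefl.MaximalIndependentCode X ↔
      UniquelyDecodable X ∧ (editRel C).antirefl.Independent X ∧ Complete X := by
  constructor
  · intro h
    refine ⟨h.prop.1, h.prop.2, ?_⟩
    by_contra hcompl
    obtain ⟨z, hz, hins⟩ := exists_insert_of_not_complete h.prop.1 hcompl hC h.prop.2
    exact hz (h.le_of_ge hins (Set.subset_insert z X) (Set.mem_insert z X))
  · rintro ⟨hX, hind, hcompl⟩
    refine ⟨⟨hX, hind⟩, fun Y hY hXY z hzY => ?_⟩
    by_contra hz
    exact not_uniquelyDecodable_insert_of_complete hn hcompl hz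
      (uniquelyDecodable_mono (Set.insert_subset hzY hXY) hY.1)

section BoundedSearch

variable {α β : Type*} [Primcodable α] [Primcodable β]

theorem primrecPred_exists_mem {p : α → β → Prop} (hp : PrimrecRel p) {f : α → List β}
    (hf : Primrec f) : PrimrecPred fun a => ∃ b ∈ f a, p a b :=
  PrimrecRel.comp (PrimrecRel.exists_mem_list (PrimrecRel.swap hp)) hf Primrec.id

theorem primrecRel_list_mem : PrimrecRel fun (b : β) (l : List β) => b ∈ l :=
  (primrecPred_exists_mem (p := fun (q : β × List β) c => c = q.1)
    (Primrec.eq.comp Primrec.snd (Primrec.fst.comp Primrec.fst)) Primrec.snd).of_eq fun _ => by simp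

theorem primrec₂_pow : Primrec₂ ((· ^ ·) : ℕ → ℕ → ℕ) := Primrec₂.unpaired'.1 Nat.Primrec.pow

/-- The words of length at most `n` over the letters listed in `S`. -/
def wordsUpTo (S : List β) (n : ℕ) : List (List β) :=
  (fun W => [] :: S.flatMap fun b => W.map (b :: ·))^[n] [[]]

theorem mem_wordsUpTo {β : Type*} {S : List β} {n : ℕ} {w : List β} :
    w ∈ wordsUpTo S n ↔ w.length ≤ n ∧ ∀ b ∈ w, b ∈ S := by
  induction n generalizing w with
  | zero => cases w <;> simp [wordsUpTo]
  | succ n ih =>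
    rw [wordsUpTo, Function.iterate_succ_apply', ← wordsUpTo]
    cases w with
    | nil => simp
    | cons c w =>
      simp only [List.mem_cons, reduceCtorEq, List.mem_flatMap, List.mem_map, List.cons.injEq,
        exists_eq_right_right, false_or, ih, List.length_cons, Nat.succ_le_succ_iff,
        forall_eq_or_imp]
      grind

theorem primrec₂_wordsUpTo : Primrec₂ (wordsUpTo : List β → ℕ → List (List β)) := by
  have hcons : Primrec₂ fun (r : ((List β × ℕ) × List (List β)) × β) (w : List β) => r.2 :: w :=
    Primrec.list_cons.comp (Primrec.snd.comp Primrec.fst) Primrec.snd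
  have hmap : Primrec₂ fun (q : (List β × ℕ) × List (List β)) (b : β) => q.2.map (b :: ·) :=
    Primrec.list_map (Primrec.snd.comp Primrec.fst) hcons
  exact Primrec.nat_iterate Primrec.snd (Primrec.const [[]]) (Primrec.list_cons.comp
    (Primrec.const []) (Primrec.list_flatMap (Primrec.fst.comp Primrec.fst) hmap))

theorem primrecPred_exists_length_le [Finite β] {p : α → List β → Prop} (hp : PrimrecRel p)
    {f : α → ℕ} (hf : Primrec f) : PrimrecPred fun a => ∃ w : List β, w.length ≤ f a ∧ p a w := by
  have := Fintype.ofFinite β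
  exact (primrecPred_exists_mem hp
    (primrec₂_wordsUpTo.comp (Primrec.const Finset.univ.toList) hf)).of_eq
    fun a => by simp [mem_wordsUpTo]

end BoundedSearch

section EffectiveRegularity

variable {A α β : Type*} [Primcodable A] [Primcodable α] [Primcodable β]

/-- A family of languages with a primitive recursive membership problem and a primitive recursive
bound on the index. This is what it takes to search these languages exhaustively, and it spares
the construction of automata. -/
structure IsEffectivelyRegular (Y : α → Language A) : Prop where
  primrecRel_mem : PrimrecRel fun a w => w ∈ Y a
  exists_hasIndex : ∃ n : α → ℕ, Primrec n ∧ ∀ a, HasIndex (Y a) (n a)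

namespace IsEffectivelyRegular

variable {Y Z : α → Language A}

theorem comp (hY : IsEffectivelyRegular Y) {f : β → α} (hf : Primrec f) :
    IsEffectivelyRegular fun b => Y (f b) := by
  obtain ⟨n, hn, hYn⟩ := hY.exists_hasIndex
  exact ⟨hY.primrecRel_mem.comp (hf.comp Primrec.fst) Primrec.snd, fun b => n (f b), hn.comp hf,
    fun b => hYn (f b)⟩

theorem singleton : IsEffectivelyRegular fun w : List A => ({w} : Language A) :=
  ⟨PrimrecRel.swap Primrec.eq, _, Primrec.nat_add.comp Primrec.list_length (Primrec.const 2),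
    hasIndex_singleton⟩

theorem inf (hY : IsEffectivelyRegular Y) (hZ : IsEffectivelyRegular Z) :
    IsEffectivelyRegular fun a => Y a ⊓ Z a := by
  obtain ⟨n, hn, hYn⟩ := hY.exists_hasIndex
  obtain ⟨m, hm, hZm⟩ := hZ.exists_hasIndex
  exact ⟨PrimrecPred.and hY.primrecRel_mem hZ.primrecRel_mem, _, Primrec.nat_mul.comp hn hm,
    fun a => (hYn a).inf (hZm a)⟩

theorem sup (hY : IsEffectivelyRegular Y) (hZ : IsEffectivelyRegular Z) :
    IsEffectivelyRegular fun a => Y a ⊔ Z a := by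
  obtain ⟨n, hn, hYn⟩ := hY.exists_hasIndex
  obtain ⟨m, hm, hZm⟩ := hZ.exists_hasIndex
  exact ⟨PrimrecPred.or hY.primrecRel_mem hZ.primrecRel_mem, _, Primrec.nat_mul.comp hn hm,
    fun a => (hYn a).sup (hZm a)⟩

theorem compl (hY : IsEffectivelyRegular Y) : IsEffectivelyRegular fun a => (Y a)ᶜ := by
  obtain ⟨n, hn, hYn⟩ := hY.exists_hasIndex
  exact ⟨hY.primrecRel_mem.not, n, hn, fun a => (hYn a).compl⟩

theorem top : IsEffectivelyRegular fun _ : α => (⊤ : Language A) := by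
  refine ⟨⟨fun _ => isTrue trivial, Primrec.const true⟩, fun _ => 1, Primrec.const 1, fun _ => ?_⟩
  simpa using HasIndex.of_finite (L := (⊤ : Language A)) (fun _ => ()) fun _ _ _ _ h => h

theorem leftQuotient (hY : IsEffectivelyRegular Y) :
    IsEffectivelyRegular fun q : α × List A => (Y q.1).leftQuotient q.2 := by
  obtain ⟨n, hn, hYn⟩ := hY.exists_hasIndex
  exact ⟨hY.primrecRel_mem.comp (Primrec.fst.comp Primrec.fst)
    (Primrec.list_append.comp (Primrec.snd.comp Primrec.fst) Primrec.snd),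
    fun q => n q.1, hn.comp Primrec.fst, fun q => (hYn q.1).leftQuotient q.2⟩

variable [Finite A]

theorem primrecPred_exists_mem (hY : IsEffectivelyRegular Y) :
    PrimrecPred fun a => ∃ w, w ∈ Y a := by
  obtain ⟨n, hn, hYn⟩ := hY.exists_hasIndex
  refine (primrecPred_exists_length_le hY.primrecRel_mem hn).of_eq fun a => ?_
  refine ⟨fun ⟨w, _, hw⟩ => ⟨w, hw⟩, fun h => ?_⟩
  obtain ⟨w, hw, hlen⟩ := (hYn a).exists_length_lt h
  exact ⟨w, hlen.le, hw⟩

theorem rightQuotient (hY : IsEffectivelyRegular Y) (hZ : IsEffectivelyRegular Z) :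
    IsEffectivelyRegular fun a => rightQuotient (Y a) (Z a) := by
  obtain ⟨n, hn, hYn⟩ := hY.exists_hasIndex
  exact ⟨((hZ.comp Primrec.fst).inf hY.leftQuotient).primrecPred_exists_mem, n, hn,
    fun a => (hYn a).rightQuotient (Z a)⟩

theorem factors (hY : IsEffectivelyRegular Y) : IsEffectivelyRegular fun a => factors (Y a) := by
  obtain ⟨n, hn, hYn⟩ := hY.exists_hasIndex
  have hleft : IsEffectivelyRegular fun q : α × List A =>
      EditCodes.rightQuotient (EditCodes.rightQuotient (Y q.1) ⊤) {q.2} :=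
    ((hY.rightQuotient top).comp Primrec.fst).rightQuotient (singleton.comp Primrec.snd)
  refine ⟨hleft.primrecPred_exists_mem.of_eq fun q => ?_, _,
    primrec₂_pow.comp (Primrec.const 2) hn, fun a => (hYn a).factors⟩
  exact exists_congr fun u => ⟨fun ⟨w, hw, v, _, h⟩ => ⟨v, by rwa [← Set.mem_singleton_iff.1 hw]⟩,
    fun ⟨v, h⟩ => ⟨q.2, rfl, v, trivial, h⟩⟩

theorem kstar (hY : IsEffectivelyRegular Y) : IsEffectivelyRegular fun a => (Y a)∗ := by
  have := Fintype.ofFinite A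
  obtain ⟨n, hn, hYn⟩ := hY.exists_hasIndex
  refine ⟨?_, _, Primrec.nat_mul.comp (primrec₂_pow.comp (Primrec.const 2) hn) (Primrec.const 2),
    fun a => (hYn a).kstar⟩
  have hall : PrimrecRel fun (q : α × List A) (l : List (List A)) => ∀ y ∈ l, y ∈ Y q.1 :=
    PrimrecRel.comp (PrimrecRel.forall_mem_list (PrimrecRel.swap hY.primrecRel_mem)) Primrec.snd
      (Primrec.fst.comp Primrec.fst)
  have hfactorization : PrimrecRel fun (q : α × List A) (l : List (List A)) =>
      q.2 = l.flatten ∧ ∀ y ∈ l, y ∈ Y q.1 :=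
    PrimrecPred.and (Primrec.eq.comp (Primrec.snd.comp Primrec.fst)
      (Primrec.list_flatten.comp Primrec.snd)) hall
  have hbound : Primrec fun q : α × List A => q.2.length := Primrec.list_length.comp Primrec.snd
  refine (EditCodes.primrecPred_exists_mem hfactorization (primrec₂_wordsUpTo.comp
    (primrec₂_wordsUpTo.comp (Primrec.const Finset.univ.toList) hbound) hbound)).of_eq ?_
  rintro ⟨a, w⟩
  refine ⟨fun ⟨l, _, h⟩ => ⟨l, h⟩, fun hw => ?_⟩
  replace hw : w ∈ (Y a)∗ := hw
  rw [Language.kstar_def_nonempty] at hw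
  obtain ⟨l, rfl, hl⟩ := hw
  have hlength : l.length ≤ l.flatten.length := by
    rw [List.length_flatten, ← List.length_map (f := List.length)]
    exact List.length_le_sum_of_one_le _
      (List.forall_mem_map.2 fun y hy => List.length_pos_of_ne_nil (hl y hy).2)
  simp only [mem_wordsUpTo, Finset.mem_toList, Finset.mem_univ, implies_true, and_true]
  exact ⟨l, ⟨hlength, fun y hy => (List.sublist_flatten_of_mem hy).length_le⟩, rfl,
    fun y hy => (hl y hy).1⟩

theorem overlaps (hY : IsEffectivelyRegular Y) : IsEffectivelyRegular fun a => overlaps (Y a) :=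
  hY.inf (hY.rightQuotient ((hY.kstar.rightQuotient hY.kstar).inf
    (singleton.comp (Primrec.const [])).compl))

theorem primrecPred_uniquelyDecodable (hY : IsEffectivelyRegular Y) :
    PrimrecPred fun a => UniquelyDecodable (Y a : Set (List A)) :=
  ((hY.primrecRel_mem.comp Primrec.id (Primrec.const [])).not.and
    hY.overlaps.primrecPred_exists_mem.not).of_eq fun _ => uniquelyDecodable_iff.symm

theorem primrecPred_complete (hY : IsEffectivelyRegular Y) : PrimrecPred fun a => Complete (Y a) :=
  hY.kstar.factors.compl.primrecPred_exists_mem.not.of_eq fun _ => not_exists_not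

end IsEffectivelyRegular

end EffectiveRegularity

theorem image_reflClosure {A : Type*} (τ : WordRel A) (Y : Set (List A)) :
    τ.reflClosure.image Y = τ.antirefl.image Y ∪ Y := by
  ext w
  constructor
  · rintro ⟨x, hx, h⟩
    by_cases hxw : x = w
    · exact Or.inr (hxw ▸ hx)
    · exact Or.inl ⟨x, hx, h.resolve_right hxw, hxw⟩
  · rintro (⟨x, hx, h, -⟩ | h)
    exacts [⟨x, hx, Or.inl h⟩, ⟨w, h, Or.inr rfl⟩]

section EffectiveEdits

variable {A α β : Type*} [Primcodable α] [Primcodable β]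

/-- A family of sets of costs with a primitive recursive membership problem and a primitive
recursive bound on the number of edit operations. -/
structure IsCostFamily (C : α → Set (ℕ × ℕ × ℕ)) : Prop where
  primrecRel_mem : PrimrecRel fun a c => c ∈ C a
  exists_total_le : ∃ K : α → ℕ, Primrec K ∧ ∀ a, ∀ c ∈ C a, total c ≤ K a

theorem primrec_total : Primrec total :=
  Primrec.nat_add.comp (Primrec.nat_add.comp Primrec.fst (Primrec.fst.comp Primrec.snd))
    (Primrec.snd.comp Primrec.snd)

theorem IsCostFamily.comp {C : α → Set (ℕ × ℕ × ℕ)} (hC : IsCostFamily C) {f : β → α}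
    (hf : Primrec f) : IsCostFamily fun b => C (f b) := by
  obtain ⟨K, hK, hCK⟩ := hC.exists_total_le
  exact ⟨hC.primrecRel_mem.comp (hf.comp Primrec.fst) Primrec.snd, _, hK.comp hf,
    fun b => hCK (f b)⟩

variable [Primcodable A]

namespace Script

theorem primrec_source : Primrec (source : Script A → List A) :=
  Primrec.listFilterMap Primrec.id (Primrec.fst.comp Primrec.snd)

theorem primrec_target : Primrec (target : Script A → List A) :=
  Primrec.listFilterMap Primrec.id (Primrec.snd.comp Primrec.snd)

theorem primrec_cost : Primrec (cost : Script A → ℕ × ℕ × ℕ) := by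
  have hdeletion : PrimrecPred fun p : Option A × Option A => p.2.isNone :=
    (Primrec.eq.comp Primrec.snd (Primrec.const none)).of_eq fun p => by simp
  have hinsertion : PrimrecPred fun p : Option A × Option A => p.1.isNone :=
    (Primrec.eq.comp Primrec.fst (Primrec.const none)).of_eq fun p => by simp
  have heq : PrimrecPred fun p : Option A × Option A => p.1 = p.2 :=
    Primrec.eq.comp Primrec.fst Primrec.snd
  classical
  refine (Primrec.pair (Primrec.list_length.comp (Primrec.listFilter hdeletion)) (Primrec.pair
    (Primrec.list_length.comp (Primrec.listFilter hinsertion)) (Primrec.list_length.comp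
      (Primrec.listFilter (hinsertion.not.and (hdeletion.not.and heq.not)))))).of_eq fun e => ?_
  simp only [cost, List.countP_eq_length_filter, Prod.mk.injEq]
  refine ⟨?_, ?_, ?_⟩ <;> congr! 2 <;> ext ⟨_ | _, _ | _⟩ <;> simp

end Script

/-- A script is longer than its target by the number of its deletions. This bounds the search for
the scripts that produce a given word. -/
theorem IsEffectivelyRegular.image_antirefl_editRel [Finite A] {X : α → Language A}
    (hX : IsEffectivelyRegular X) {C : α → Set (ℕ × ℕ × ℕ)} (hC : IsCostFamily C) :
    IsEffectivelyRegular fun a => ((editRel (C a)).antirefl.image (X a) : Language A) := by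
  obtain ⟨n, hn, hXn⟩ := hX.exists_hasIndex
  obtain ⟨K, hK, hCK⟩ := hC.exists_total_le
  have hscript : PrimrecRel fun (q : α × List A) (e : Script A) => e.source ∈ X q.1 ∧
      e.target = q.2 ∧ e.cost ∈ C q.1 ∧ e.source ≠ q.2 :=
    have ha : Primrec fun r : (α × List A) × Script A => r.1.1 := Primrec.fst.comp Primrec.fst
    have hw : Primrec fun r : (α × List A) × Script A => r.1.2 := Primrec.snd.comp Primrec.fst
    have hsource : Primrec fun r : (α × List A) × Script A => r.2.source :=
      Script.primrec_source.comp Primrec.snd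
    (hX.primrecRel_mem.comp ha hsource).and
      ((Primrec.eq.comp (Script.primrec_target.comp Primrec.snd) hw).and
        ((hC.primrecRel_mem.comp ha (Script.primrec_cost.comp Primrec.snd)).and
          (Primrec.eq.comp hsource hw).not))
  have hlength : Primrec fun q : α × List A => q.2.length + K q.1 :=
    Primrec.nat_add.comp (Primrec.list_length.comp Primrec.snd) (hK.comp Primrec.fst)
  refine ⟨(primrecPred_exists_length_le hscript hlength).of_eq ?_, _, ?_,
    fun a => (hXn a).image_antirefl_editRel (hCK a)⟩
  · rintro ⟨a, w⟩
    constructor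
    · rintro ⟨e, -, hx, he, hc, hne⟩
      exact ⟨_, hx, ⟨e, rfl, he, hc⟩, hne⟩
    · rintro ⟨_, hx, ⟨e, rfl, rfl, hc⟩, hne⟩
      refine ⟨e, ?_, hx, rfl, hc, hne⟩
      have hdeletions : e.cost.1 ≤ total e.cost := by unfold total; omega
      exact e.length_target_add.ge.trans (Nat.add_le_add_left (hdeletions.trans (hCK a _ hc)) _)
  · have hK₁ : Primrec fun a => K a + 1 := Primrec.succ.comp hK
    have hpow : Primrec fun a => (Nat.card A + 1) ^ K a := primrec₂_pow.comp (Primrec.const _) hK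
    exact primrec₂_pow.comp (Primrec.const 2) (Primrec.nat_mul.comp hn (Primrec.nat_mul.comp
      (Primrec.nat_mul.comp hK₁ (Primrec.nat_mul.comp hK₁ hK₁))
      (Primrec.nat_mul.comp hpow (Primrec.nat_mul.comp hpow (Primrec.const 2)))))

section Decision

variable [Finite A] {X : α → Language A} {C : α → Set (ℕ × ℕ × ℕ)}

theorem IsEffectivelyRegular.primrecPred_independent (hX : IsEffectivelyRegular X)
    (hC : IsCostFamily C) :
    PrimrecPred fun a => (editRel (C a)).antirefl.Independent (X a : Set (List A)) :=
  ((hX.image_antirefl_editRel hC).inf hX).primrecPred_exists_mem.not.of_eq fun _ =>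
    Set.not_nonempty_iff_eq_empty

theorem IsEffectivelyRegular.image_reflClosure_editRel (hX : IsEffectivelyRegular X)
    (hC : IsCostFamily C) :
    IsEffectivelyRegular fun a => ((editRel (C a)).reflClosure.image (X a) : Language A) := by
  have hsup : (fun a => ((editRel (C a)).reflClosure.image (X a) : Language A)) = fun a =>
      ((editRel (C a)).antirefl.image (X a) : Language A) ⊔ X a :=
    funext fun a => image_reflClosure _ _
  exact hsup ▸ (hX.image_antirefl_editRel hC).sup hX

theorem IsEffectivelyRegular.primrecPred_maximalIndependentCode [Nontrivial A]
    (hX : IsEffectivelyRegular X) (hC : IsCostFamily C) :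
    PrimrecPred fun a => (editRel (C a)).antirefl.MaximalIndependentCode (X a : Set (List A)) := by
  obtain ⟨_, -, hXn⟩ := hX.exists_hasIndex
  obtain ⟨_, -, hCK⟩ := hC.exists_total_le
  exact (hX.primrecPred_uniquelyDecodable.and ((hX.primrecPred_independent hC).and
    hX.primrecPred_complete)).of_eq fun a => (maximalIndependentCode_iff (hXn a) (hCK a)).symm

theorem IsEffectivelyRegular.exists_primrecPred_errorCorrecting (hX : IsEffectivelyRegular X)
    (hC : IsCostFamily C) :
    ∃ D : α → Prop, PrimrecPred D ∧ ∀ a, {w | w ∈ X a}.Finite →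
      (D a ↔ (editRel (C a)).antirefl.ErrorCorrecting (X a : Set (List A))) := by
  obtain ⟨n, hn, hXn⟩ := hX.exists_hasIndex
  have himage : IsEffectivelyRegular fun q : α × List A =>
      ((editRel (C q.1)).antirefl.image {q.2} : Language A) :=
    (IsEffectivelyRegular.singleton.comp Primrec.snd).image_antirefl_editRel (hC.comp Primrec.fst)
  have hconflict : PrimrecRel fun (q : α × List A) (y : List A) => q.2 ∈ X q.1 ∧ y ∈ X q.1 ∧
      (∃ z, z ∈ (editRel (C q.1)).antirefl.image {q.2} ∧
        z ∈ (editRel (C q.1)).antirefl.image {y}) ∧ q.2 ≠ y :=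
    have ha : Primrec fun r : (α × List A) × List A => r.1.1 := Primrec.fst.comp Primrec.fst
    have hx : Primrec fun r : (α × List A) × List A => r.1.2 := Primrec.snd.comp Primrec.fst
    (hX.primrecRel_mem.comp ha hx).and ((hX.primrecRel_mem.comp ha Primrec.snd).and
      (((himage.comp Primrec.fst).inf
        (himage.comp (Primrec.pair ha Primrec.snd))).primrecPred_exists_mem.and
        (Primrec.eq.comp hx Primrec.snd).not))
  have hshort : PrimrecRel fun (a : α) (x : List A) => ∃ y : List A, y.length ≤ n a ∧
      x ∈ X a ∧ y ∈ X a ∧ (∃ z, z ∈ (editRel (C a)).antirefl.image {x} ∧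
        z ∈ (editRel (C a)).antirefl.image {y}) ∧ x ≠ y :=
    primrecPred_exists_length_le hconflict (hn.comp Primrec.fst)
  refine ⟨_, (primrecPred_exists_length_le hshort hn).not, fun a hfin => ?_⟩
  constructor
  · intro h x hx y hy hz
    by_contra hne
    exact h ⟨x, ((hXn a).length_lt_of_finite hfin hx).le, y,
      ((hXn a).length_lt_of_finite hfin hy).le, hx, hy, hz, hne⟩
  · rintro h ⟨x, -, y, -, hx, hy, hz, hne⟩
    exact hne (h x hx y hy hz)

end Decision

end EffectiveEdits

namespace FinAut

variable {A : Type*}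

open scoped Classical in
/-- The states reached from the states in `S` by reading the letter `a`. -/
noncomputable def stepList (M : FinAut A) (S : List ℕ) (a : A) : List ℕ :=
  M.2.1.filterMap fun t => if t.1 ∈ S ∧ t.2.1 = a then some t.2.2 else none

/-- The states reached from the initial states by reading the word `w`. -/
noncomputable def evalList (M : FinAut A) (w : List A) : List ℕ := w.foldl M.stepList M.1

theorem mem_evalList {M : FinAut A} {w : List A} {q : ℕ} :
    q ∈ M.evalList w ↔ q ∈ M.toNFA.eval w := by
  induction w using List.reverseRecOn generalizing q with
  | nil => simp [evalList, toNFA]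
  | append_singleton w a ih =>
    rw [NFA.eval_append_singleton, NFA.mem_stepSet, evalList, List.foldl_append]
    simp only [List.foldl_cons, List.foldl_nil, stepList, List.mem_filterMap,
      Option.ite_none_right_eq_some, Option.some.injEq]
    constructor
    · rintro ⟨⟨p, b, q'⟩, ht, ⟨hp, rfl⟩, rfl⟩
      exact ⟨p, ih.1 hp, ht⟩
    · rintro ⟨p, hp, ht⟩
      exact ⟨(p, a, q), ht, ⟨ih.2 hp, rfl⟩, rfl⟩

theorem mem_lang {M : FinAut A} {w : List A} : w ∈ M.lang ↔ ∃ q ∈ M.evalList w, q ∈ M.2.2 := by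
  simp only [mem_evalList, and_comm]
  exact NFA.mem_accepts

theorem primrec_stepList [Primcodable A] :
    Primrec fun q : FinAut A × List ℕ × A => q.1.stepList q.2.1 q.2.2 := by
  classical
  have hcond : PrimrecPred fun r : (FinAut A × List ℕ × A) × (ℕ × A × ℕ) =>
      r.2.1 ∈ r.1.2.1 ∧ r.2.2.1 = r.1.2.2 :=
    (primrecRel_list_mem.comp (Primrec.fst.comp Primrec.snd)
      (Primrec.fst.comp (Primrec.snd.comp Primrec.fst))).and
      (Primrec.eq.comp (Primrec.fst.comp (Primrec.snd.comp Primrec.snd))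
        (Primrec.snd.comp (Primrec.snd.comp Primrec.fst)))
  have hmove : Primrec₂ fun (q : FinAut A × List ℕ × A) (t : ℕ × A × ℕ) =>
      if t.1 ∈ q.2.1 ∧ t.2.1 = q.2.2 then some t.2.2 else none :=
    Primrec.ite hcond (Primrec.option_some.comp (Primrec.snd.comp (Primrec.snd.comp Primrec.snd)))
      (Primrec.const none)
  exact Primrec.listFilterMap (Primrec.fst.comp (Primrec.snd.comp Primrec.fst)) hmove

theorem primrec_evalList [Primcodable A] :
    Primrec₂ (evalList : FinAut A → List A → List ℕ) := by
  have hstep : Primrec₂ fun (q : FinAut A × List A) (r : List ℕ × A) => q.1.stepList r.1 r.2 :=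
    primrec_stepList.comp (Primrec.pair (Primrec.fst.comp Primrec.fst) Primrec.snd)
  exact Primrec.list_foldl Primrec.snd (Primrec.fst.comp Primrec.fst) hstep

theorem primrecRel_mem_lang [Primcodable A] :
    PrimrecRel fun (M : FinAut A) (w : List A) => w ∈ M.lang :=
  have haccept : PrimrecRel fun (p : FinAut A × List A) (q : ℕ) => q ∈ p.1.2.2 :=
    primrecRel_list_mem.comp Primrec.snd
      (Primrec.snd.comp (Primrec.snd.comp (Primrec.fst.comp Primrec.fst)))
  (primrecPred_exists_mem haccept primrec_evalList).of_eq fun _ => mem_lang.symm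

theorem hasIndex_lang (M : FinAut A) : HasIndex M.lang (2 ^ (M.1.length + M.2.1.length)) := by
  let F : List ℕ := M.1 ++ M.2.1.map fun t => t.2.2
  have hF : ∀ w, ∀ q ∈ M.toNFA.eval w, q ∈ F := by
    intro w q hq
    induction w using List.reverseRecOn with
    | nil => exact List.mem_append_left _ hq
    | append_singleton w a _ =>
      rw [NFA.eval_append_singleton, NFA.mem_stepSet] at hq
      obtain ⟨p, -, hp⟩ := hq
      exact List.mem_append_right _ (List.mem_map.2 ⟨(p, a, q), hp, rfl⟩)
  have hindex := HasIndex.of_finite (L := M.lang)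
    (fun u => ({j | F[j] ∈ M.toNFA.eval u} : Set (Fin F.length))) fun u u' v h hu => ?_
  · simpa [Nat.card_eq_fintype_card, F] using hindex
  have heval : M.toNFA.evalFrom M.toNFA.start u = M.toNFA.evalFrom M.toNFA.start u' := by
    ext q
    constructor <;> intro hq <;> obtain ⟨j, hj, rfl⟩ := List.getElem_of_mem (hF _ _ hq)
    exacts [(Set.ext_iff.1 h ⟨j, hj⟩).1 hq, (Set.ext_iff.1 h ⟨j, hj⟩).2 hq]
  have hv : v ∈ M.toNFA.acceptsFrom (M.toNFA.eval u) := (NFA.append_mem_acceptsFrom M.toNFA).1 hu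
  exact (NFA.append_mem_acceptsFrom M.toNFA).2 (heval ▸ hv)

theorem isEffectivelyRegular_lang [Primcodable A] :
    IsEffectivelyRegular fun M : FinAut A => (M.lang : Language A) :=
  ⟨primrecRel_mem_lang, _, primrec₂_pow.comp (Primrec.const 2) (Primrec.nat_add.comp
    (Primrec.list_length.comp Primrec.fst)
    (Primrec.list_length.comp (Primrec.fst.comp Primrec.snd))), hasIndex_lang⟩

end FinAut

section EditFamilies

variable {A : Type*}

theorem antirefl_eq_self {τ : WordRel A} (h : ∀ w, (w, w) ∉ τ) : τ.antirefl = τ := by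
  refine sdiff_eq_self_iff_disjoint.2 (Set.disjoint_left.2 ?_)
  rintro ⟨w, _⟩ rfl
  exact h w

theorem antirefl_antirefl (τ : WordRel A) : τ.antirefl.antirefl = τ.antirefl :=
  antirefl_eq_self fun _ h => h.2 rfl

theorem antirefl_iUnion {ι : Sort*} (τ : ι → WordRel A) :
    WordRel.antirefl (⋃ i, τ i) = ⋃ i, (τ i).antirefl :=
  Set.iUnion_sdiff _ _

theorem IsCostFamily.singleton {α : Type*} [Primcodable α] {f : α → ℕ × ℕ × ℕ} (hf : Primrec f) :
    IsCostFamily fun a => {f a} where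
  primrecRel_mem := Primrec.eq.comp Primrec.snd (hf.comp Primrec.fst)
  exists_total_le := ⟨fun a => total (f a), primrec_total.comp hf, by rintro a _ rfl; rfl⟩

theorem IsCostFamily.biUnion_Icc {C : ℕ → Set (ℕ × ℕ × ℕ)} (hC : IsCostFamily C) :
    IsCostFamily fun p => ⋃ k ∈ Set.Icc 1 p, C k := by
  obtain ⟨K, hK, hCK⟩ := hC.exists_total_le
  have hrange : Primrec fun p => List.range (p + 1) := Primrec.list_range.comp Primrec.succ
  have hmem : PrimrecRel fun (q : ℕ × ℕ × ℕ × ℕ) (k : ℕ) => 1 ≤ k ∧ q.2 ∈ C k :=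
    (Primrec.nat_le.comp (Primrec.const 1) Primrec.snd).and
      (hC.primrecRel_mem.comp Primrec.snd (Primrec.snd.comp Primrec.fst))
  have hadd : Primrec₂ fun (_ : List ℕ) (q : ℕ × ℕ) => q.1 + q.2 :=
    Primrec.nat_add.comp (Primrec.fst.comp Primrec.snd) (Primrec.snd.comp Primrec.snd)
  have hsum : Primrec (List.sum : List ℕ → ℕ) :=
    Primrec.list_foldr Primrec.id (Primrec.const 0) hadd
  refine ⟨(primrecPred_exists_mem hmem (hrange.comp Primrec.fst)).of_eq fun q => ?_,
    fun p => ((List.range (p + 1)).map K).sum,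
    hsum.comp (Primrec.list_map hrange (hK.comp Primrec.snd)), fun p c hc => ?_⟩
  · simp only [List.mem_range, Nat.lt_succ_iff, Set.mem_iUnion, Set.mem_Icc, exists_prop]
    grind
  · obtain ⟨k, ⟨-, hk⟩, hc⟩ := Set.mem_iUnion₂.1 hc
    exact (hCK k c hc).trans (List.le_sum_of_mem
      (List.mem_map_of_mem (List.mem_range.2 (Nat.lt_succ_of_le hk))))

/-- A family of relations which, at each `k ≥ 1`, relates the distinct words that some edit script
with admissible cost turns into each other. The admissible costs depend on `k` in a primitive
recursive way. -/
def IsEditFamily (τ : ℕ → WordRel A) : Prop :=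
  ∃ C : ℕ → Set (ℕ × ℕ × ℕ), IsCostFamily C ∧ ∀ k, 1 ≤ k → τ k = (editRel (C k)).antirefl

namespace IsEditFamily

theorem antirefl {τ : ℕ → WordRel A} (hτ : IsEditFamily τ) :
    IsEditFamily fun k => (τ k).antirefl := by
  obtain ⟨C, hC, hτC⟩ := hτ
  exact ⟨C, hC, fun k hk => (congrArg _ (hτC k hk)).trans (antirefl_antirefl _)⟩

theorem biUnion_Icc {τ : ℕ → WordRel A} (hτ : IsEditFamily τ) :
    IsEditFamily fun p => ⋃ k ∈ Set.Icc 1 p, τ k := by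
  obtain ⟨C, hC, hτC⟩ := hτ
  refine ⟨_, hC.biUnion_Icc, fun p _ => ?_⟩
  simp only [editRel_iUnion, antirefl_iUnion]
  exact Set.iUnion₂_congr fun k hk => hτC k hk.1

theorem del : IsEditFamily (WordRel.del : ℕ → WordRel A) := by
  refine ⟨fun k => {(k, 0, 0)}, .singleton (Primrec.pair Primrec.id (Primrec.const _)),
    fun k hk => ?_⟩
  rw [← del_eq_editRel, antirefl_eq_self fun w h => ?_]
  have hlength : w.length + k = w.length := h.2
  omega

theorem ins : IsEditFamily (WordRel.ins : ℕ → WordRel A) := by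
  refine ⟨fun k => {(0, k, 0)}, .singleton (Primrec.pair (Primrec.const 0)
    (Primrec.pair Primrec.id (Primrec.const 0))), fun k hk => ?_⟩
  rw [← ins_eq_editRel, antirefl_eq_self fun w h => ?_]
  have hlength : w.length + k = w.length := h.2
  omega

theorem sub : IsEditFamily (WordRel.sub : ℕ → WordRel A) := by
  refine ⟨fun k => {(0, 0, k)}, .singleton (Primrec.pair (Primrec.const 0)
    (Primrec.pair (Primrec.const 0) Primrec.id)), fun k hk => ?_⟩
  rw [← sub_eq_editRel, antirefl_eq_self fun w h => ?_]
  have hncard : {i : ℕ | w[i]? ≠ w[i]?}.ncard = k := h.2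
  simp only [ne_eq, not_true, Set.ofPred_false, Set.ncard_empty] at hncard
  omega

theorem delUpTo : IsEditFamily (WordRel.delUpTo : ℕ → WordRel A) := del.biUnion_Icc

theorem insUpTo : IsEditFamily (WordRel.insUpTo : ℕ → WordRel A) := ins.biUnion_Icc

theorem antirefl_lev {f : ℕ → ℕ} (hf : Primrec f) :
    IsEditFamily fun k => (WordRel.lev (f k) : WordRel A).antirefl := by
  refine ⟨fun k => {c | total c ≤ f k}, ⟨?_, f, hf, fun _ _ hc => hc⟩, fun k _ =>
    EditCodes.antirefl_lev (f k)⟩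
  exact Primrec.nat_le.comp (primrec_total.comp Primrec.snd) (hf.comp Primrec.fst)

theorem antirefl_indel {f : ℕ → ℕ} (hf : Primrec f) :
    IsEditFamily fun k => (WordRel.indel (f k) : WordRel A).antirefl := by
  refine ⟨fun k => {c | c.2.2 = 0 ∧ total c ≤ f k}, ⟨?_, f, hf, fun _ _ hc => hc.2⟩, fun k _ =>
    EditCodes.antirefl_indel (f k)⟩
  exact PrimrecPred.and
    (Primrec.eq.comp (Primrec.snd.comp (Primrec.snd.comp Primrec.snd)) (Primrec.const 0))
    (Primrec.nat_le.comp (primrec_total.comp Primrec.snd) (hf.comp Primrec.fst))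

end IsEditFamily

end EditFamilies

theorem DecidableOn.of_primrecPred {α : Type*} [Primcodable α] {promise P D : α → Prop}
    (hD : PrimrecPred D) (h : ∀ a, promise a → (D a ↔ P a)) : DecidableOn promise P := by
  obtain ⟨_, hD⟩ := hD
  exact ⟨D, ⟨inferInstance, hD.to_comp⟩, h⟩

theorem DecidableOn.mono {α : Type*} [Primcodable α] {promise promise' P : α → Prop}
    (h : DecidableOn promise P) (hpromise : ∀ a, promise' a → promise a) :
    DecidableOn promise' P :=
  let ⟨D, hD, hDP⟩ := h
  ⟨D, hD, fun a ha => hDP a (hpromise a ha)⟩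

theorem mainTheorem11_general {A : Type*} [Finite A] [Nontrivial A] [Primcodable A]
    {τ : ℕ → WordRel A} (hτ : IsEditFamily τ) :
    DecidableOn (fun i : ℕ × FinAut A => 1 ≤ i.1)
        (fun i => (τ i.1).antirefl.Independent i.2.lang) ∧
      DecidableOn (fun i : ℕ × FinAut A => 1 ≤ i.1 ∧ i.2.lang.Finite)
        (fun i => (τ i.1).ErrorCorrecting i.2.lang) ∧
      DecidableOn (fun i : ℕ × FinAut A => 1 ≤ i.1)
        (fun i => (τ i.1).MaximalIndependentCode i.2.lang) ∧
      DecidableOn (fun i : ℕ × FinAut A => 1 ≤ i.1)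
        (fun i => UniquelyDecodable ((τ i.1).reflClosure.image i.2.lang)) ∧
      DecidableOn (fun i : ℕ × FinAut A => 1 ≤ i.1)
        (fun i => UniquelyDecodable ((τ i.1).antirefl.image i.2.lang)) := by
  obtain ⟨C, hC, hτC⟩ := hτ
  have hX : IsEffectivelyRegular fun i : ℕ × FinAut A => (i.2.lang : Language A) :=
    FinAut.isEffectivelyRegular_lang.comp Primrec.snd
  have hCi : IsCostFamily fun i : ℕ × FinAut A => C i.1 := hC.comp Primrec.fst
  obtain ⟨D, hD, hDiff⟩ := hX.exists_primrecPred_errorCorrecting hCi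
  refine ⟨.of_primrecPred (hX.primrecPred_independent hCi) fun i hi => ?_,
    .of_primrecPred hD fun i hi => ?_,
    .of_primrecPred (hX.primrecPred_maximalIndependentCode hCi) fun i hi => ?_,
    .of_primrecPred (hX.image_reflClosure_editRel hCi).primrecPred_uniquelyDecodable
      fun i hi => ?_,
    .of_primrecPred (hX.image_antirefl_editRel hCi).primrecPred_uniquelyDecodable
      fun i hi => ?_⟩
  · rw [hτC i.1 hi, antirefl_antirefl]
  · rw [hτC i.1 hi.1]
    exact hDiff i hi.2
  · rw [hτC i.1 hi]
  · rw [hτC i.1 hi, image_reflClosure, image_reflClosure, antirefl_antirefl]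
  · rw [hτC i.1 hi, antirefl_antirefl]

end EditCodes

theorem mainTheorem11 (A : Type*) [Finite A] [Nontrivial A] [Primcodable A] :
    (∀ τ ∈ ({WordRel.del, WordRel.ins, WordRel.sub, WordRel.delUpTo, WordRel.insUpTo,
          fun k => (WordRel.indel k).antirefl, fun k => (WordRel.lev k).antirefl} :
          Set (ℕ → WordRel A)),
      -- (i) finite codes
      (DecidableOn FinAut.IsFiniteCodeInstance
          (fun i : ℕ × FinAut A => (τ i.1).antirefl.Independent i.2.lang) ∧
        DecidableOn FinAut.IsFiniteCodeInstance
          (fun i : ℕ × FinAut A => (τ i.1).ErrorCorrecting i.2.lang) ∧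
        DecidableOn FinAut.IsFiniteCodeInstance
          (fun i : ℕ × FinAut A => (τ i.1).MaximalIndependentCode i.2.lang) ∧
        DecidableOn FinAut.IsFiniteCodeInstance
          (fun i : ℕ × FinAut A => UniquelyDecodable ((τ i.1).reflClosure.image i.2.lang)) ∧
        DecidableOn FinAut.IsFiniteCodeInstance
          (fun i : ℕ × FinAut A => UniquelyDecodable ((τ i.1).antirefl.image i.2.lang))) ∧
      -- (ii) regular codes
      (DecidableOn FinAut.IsCodeInstance
          (fun i : ℕ × FinAut A => (τ i.1).MaximalIndependentCode i.2.lang) ∧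
        DecidableOn FinAut.IsCodeInstance
          (fun i : ℕ × FinAut A => UniquelyDecodable ((τ i.1).reflClosure.image i.2.lang)))) ∧
    -- (iii) regular codes, with `S_k` and `Λ_k` for `k = 1` only
    (∀ τ ∈ ({WordRel.del, WordRel.ins, WordRel.sub, WordRel.delUpTo, WordRel.insUpTo,
          fun _ => WordRel.indel 1, fun _ => WordRel.lev 1} : Set (ℕ → WordRel A)),
      DecidableOn FinAut.IsCodeInstance
          (fun i : ℕ × FinAut A => (τ i.1).antirefl.Independent i.2.lang) ∧
        DecidableOn FinAut.IsCodeInstance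
          (fun i : ℕ × FinAut A => UniquelyDecodable ((τ i.1).antirefl.image i.2.lang))) := by
  refine ⟨fun τ hτ => ?_, fun τ hτ => ?_⟩
  · have hfamily : IsEditFamily τ := by
      rcases hτ with rfl | rfl | rfl | rfl | rfl | rfl | rfl
      exacts [.del, .ins, .sub, .delUpTo, .insUpTo, .antirefl_indel Primrec.id,
        .antirefl_lev Primrec.id]
    obtain ⟨hc₂, hc₃, hc₄, hc₅, hc₆⟩ := mainTheorem11_general hfamily
    exact ⟨⟨hc₂.mono fun _ hi => hi.1.1, hc₃.mono fun _ hi => ⟨hi.1.1, hi.2⟩,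
      hc₄.mono fun _ hi => hi.1.1, hc₅.mono fun _ hi => hi.1.1, hc₆.mono fun _ hi => hi.1.1⟩,
      hc₄.mono fun _ hi => hi.1, hc₅.mono fun _ hi => hi.1⟩
  · have hfamily : IsEditFamily fun k => (τ k).antirefl := by
      rcases hτ with rfl | rfl | rfl | rfl | rfl | rfl | rfl
      exacts [.antirefl .del, .antirefl .ins, .antirefl .sub, .antirefl .delUpTo,
        .antirefl .insUpTo, .antirefl_indel (Primrec.const 1), .antirefl_lev (Primrec.const 1)]
    obtain ⟨hc₂, -, -, -, hc₆⟩ := mainTheorem11_general hfamily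
    simp only [antirefl_antirefl] at hc₂ hc₆
    exact ⟨hc₂.mono fun _ hi => hi.1, hc₆.mono fun _ hi => hi.1⟩
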